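/- Let $\Gamma=(\mathcal V,\mathcal E)$ be a finite simple graph that is chordal (every cycle with more than three vertices has a chord), with a total order on $\mathcal V$. For an edge $e$ let $h(e)$ be its larger and $t(e)$ its smaller vertex, and order the edges by $e<e'$ if $h(e)<h(e')$, or $h(e)=h(e')$ and $t(e)<t(e')$. Let $C$ be a smooth complex projective curve of genus $g>1$, and let $\mathcal A=\mathcal A(\Gamma,C)$ be the chordal arrangement of the diagonals $H_e=\{z\in C^{\mathcal V} : z_{h(e)}=z_{t(e)}\}$, $e\in\mathcal E$. Let $A(\mathcal A)$ be the underlying graded algebra of the Dupont–Bloch model of the complement of $\mathcal A$; it depends only on $\Gamma$ and $g$, and is defined as the exterior algebra over $\mathbb Q$ on generators $$x_v^i,\quad y_v^i,\quad g_e\qquad (v\in\mathcal V,\ e\in\mathcal E,\ i=1,\dots,g),$$ all of degree $1$, modulo the two-sided ideal generated by 1. $\sum_j(-1)^j g_{e_1}\cdots\widehat{g_{e_j}}\cdots g_{e_k}$ whenever $\{e_1<\cdots<e_k\}$ is the edge set of a cycle of $\Gamma$; 2. $(x^i_{h(e)}-x^i_{t(e)})g_e$ and $(y^i_{h(e)}-y^i_{t(e)})g_e$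 for all $e\in\mathcal E$ and all $i$; 3. $x_v^iy_v^j$, $x_v^ix_v^j$, $y_v^iy_v^j$ for $i\ne j$, and $x_v^iy_v^i-x_v^jy_v^j$ for all $i,j$, for every $v\in\mathcal V$. Then $A(\mathcal A)$ is a Koszul algebra. That is, $A=A(\mathcal A)$ is a connected graded algebra with finite-dimensional graded pieces, and the trivial module $\mathbb Q=A/A_+$ has a linear free resolution: an exact sequence $\cdots\to P_2\to P_1\to P_0\to\mathbb Q\to 0$ of graded left $A$-modules and degree-$0$ maps in which each $P_n$ is free on generators of degree $n$. -/

import Mathlib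

universe u v

/-! ### Koszul algebras -/

/-- `𝒜` makes the `k`-algebra `A` a connected `ℕ`-graded algebra: `A = ⨁ n, 𝒜 n` as a graded
algebra, and `𝒜 0 = k · 1 ≅ k`. -/
structure IsConnectedGrading (k : Type v) {A : Type u} [Field k] [Ring A] [Algebra k A]
    (𝒜 : ℕ → Submodule k A) : Prop where
  nontrivial : Nontrivial A
  gradedMonoid : SetLike.GradedMonoid 𝒜
  isInternal : DirectSum.IsInternal 𝒜
  zero_eq : 𝒜 0 = 1

/-- The augmentation ideal `A₊`, as a left ideal: it is generated by the homogeneous elements of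
positive degree. For a connected graded algebra, `A ⧸ A₊` is the trivial `A`-module `k`. -/
def augmentationIdeal {k : Type v} {A : Type u} [Field k] [Ring A] [Algebra k A]
    (𝒜 : ℕ → Submodule k A) : Ideal A :=
  Ideal.span {a | ∃ n, 1 ≤ n ∧ a ∈ 𝒜 n}

/-- The trivial left module `k = A ⧸ A₊` has a linear free resolution: an exact sequence
`⋯ → P₂ → P₁ → P₀ → k → 0` of graded left `A`-modules and maps of degree `0`, in which `Pₙ` is
free on generators of degree `n`, that is `Pₙ = ⨁_{b ∈ ι n} A(-n)`. A map `Pₙ₊₁ → Pₙ` has degree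
`0` exactly when the entries of its matrix lie in `𝒜 1`. -/
def HasLinearFreeResolution {k : Type v} {A : Type u} [Field k] [Ring A] [Algebra k A]
    (𝒜 : ℕ → Submodule k A) : Prop :=
  ∃ (ι : ℕ → Type u)
    (ε : (ι 0 →₀ A) →ₗ[A] A ⧸ augmentationIdeal 𝒜)
    (d : ∀ n, (ι (n + 1) →₀ A) →ₗ[A] (ι n →₀ A)),
    Function.Surjective ε ∧
    Function.Exact (d 0) ε ∧
    (∀ n, Function.Exact (d (n + 1)) (d n)) ∧
    ∀ n (b : ι (n + 1)) (c : ι n), d n (Finsupp.single b 1) c ∈ 𝒜 1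

/-- The `k`-algebra `A` with the grading `𝒜` is a Koszul algebra: it is connected graded, each
graded piece is finite dimensional, and the trivial module `k` has a linear free resolution. -/
structure IsKoszulAlgebra (k : Type v) {A : Type u} [Field k] [Ring A] [Algebra k A]
    (𝒜 : ℕ → Submodule k A) : Prop where
  connected : IsConnectedGrading k 𝒜
  finiteDimensional : ∀ n, FiniteDimensional k (𝒜 n)
  linearResolution : HasLinearFreeResolution 𝒜

/-! ### Chordal graphs -/

/-- Every cycle with more than three vertices has a chord: an edge of the graph which joins two
vertices of the cycle and is not an edge of the cycle. -/
def IsChordalGraph {V : Type u} (Γ : SimpleGraph V) : Prop :=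
  ∀ (v : V) (w : Γ.Walk v v), w.IsCycle → 3 < w.length →
    ∃ a ∈ w.support, ∃ b ∈ w.support, Γ.Adj a b ∧ s(a, b) ∉ w.edges

/-! ### The model of the complement of a graphic arrangement -/

namespace CurveArrangement

variable {V : Type u} [LinearOrder V] {Γ : SimpleGraph V}

/-- The head of an edge is its larger vertex. -/
def head (e : Γ.edgeSet) : V := e.1.sup

/-- The tail of an edge is its smaller vertex. -/
def tail (e : Γ.edgeSet) : V := e.1.inf

/-- The order on the edges: compare the heads first, then the tails. -/
def EdgeLT (e e' : Γ.edgeSet) : Prop :=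
  head e < head e' ∨ (head e = head e' ∧ tail e < tail e')

/-- The list `l = [e₁, …, eₖ]` is strictly increasing and its entries are exactly the edges of a
cycle of the graph. -/
def IsOrderedCycle (l : List Γ.edgeSet) : Prop :=
  l.Pairwise EdgeLT ∧
    ∃ (v : V) (w : Γ.Walk v v), w.IsCycle ∧ ∀ e : Γ.edgeSet, e ∈ l ↔ e.1 ∈ w.edges

/-- Names of the generators `xᵢᵥ`, `yᵢᵥ` (`v` a vertex, `i = 1, …, g`) and `gₑ` (`e` an edge). -/
inductive Generator (Γ : SimpleGraph V) (g : ℕ) : Type u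
  | x (i : Fin g) (v : V)
  | y (i : Fin g) (v : V)
  | edge (e : Γ.edgeSet)

variable (Γ) in
/-- The exterior algebra on the `ℚ`-vector space with basis the generators. -/
abbrev FreeModel (g : ℕ) : Type u := ExteriorAlgebra ℚ (Generator Γ g →₀ ℚ)

/-- A generator, as an element of the exterior algebra. -/
noncomputable def gen {g : ℕ} (s : Generator Γ g) : FreeModel Γ g :=
  ExteriorAlgebra.ι ℚ (Finsupp.single s 1)

/-- The element `x i v` of the exterior algebra. -/
noncomputable def X {g : ℕ} (i : Fin g) (v : V) : FreeModel Γ g := gen (Generator.x i v)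

/-- The element `y i v` of the exterior algebra. -/
noncomputable def Y {g : ℕ} (i : Fin g) (v : V) : FreeModel Γ g := gen (Generator.y i v)

/-- The element `gₑ` of the exterior algebra. -/
noncomputable def E {g : ℕ} (e : Γ.edgeSet) : FreeModel Γ g := gen (Generator.edge e)

/-- For `l = [e₁, …, eₖ]`, the element `∑ⱼ (-1)ʲ g_{e₁} ⋯ ĝ_{eⱼ} ⋯ g_{eₖ}`. (The index `j` below
starts at `0`, hence the exponent `j + 1`.) -/
noncomputable def orlikSolomonElement {g : ℕ} (l : List Γ.edgeSet) : FreeModel Γ g :=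
  ∑ j ∈ Finset.range l.length, (-1) ^ (j + 1) * ((l.eraseIdx j).map E).prod

/-- The defining relators of the model: the Orlik-Solomon relators, the diagonal relators, and
the relators of the cohomology ring of the curve, for each vertex. -/
inductive IsRelator {g : ℕ} : FreeModel Γ g → Prop
  | orlikSolomon (l : List Γ.edgeSet) (hl : IsOrderedCycle l) : IsRelator (orlikSolomonElement l)
  | diagonal_x (i : Fin g) (e : Γ.edgeSet) : IsRelator ((X i (head e) - X i (tail e)) * E e)
  | diagonal_y (i : Fin g) (e : Γ.edgeSet) : IsRelator ((Y i (head e) - Y i (tail e)) * E e)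
  | x_mul_y (i j : Fin g) (hij : i ≠ j) (v : V) : IsRelator (X i v * Y j v)
  | x_mul_x (i j : Fin g) (hij : i ≠ j) (v : V) : IsRelator (X i v * X j v)
  | y_mul_y (i j : Fin g) (hij : i ≠ j) (v : V) : IsRelator (Y i v * Y j v)
  | point_class (i j : Fin g) (v : V) : IsRelator (X i v * Y i v - X j v * Y j v)

variable (Γ) in
/-- The underlying algebra of the model of the complement of the arrangement of the diagonals
`z_{h(e)} = z_{t(e)}`, `e` an edge of `Γ`, in the power `C ^ V` of a curve `C` of genus `g`:
the exterior algebra modulo the two-sided ideal generated by the relators. -/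
abbrev Model (g : ℕ) : Type u :=
  RingQuot (fun a b : FreeModel Γ g => IsRelator a ∧ b = 0)

variable (Γ) in
/-- The grading of the model in which all generators have degree `1`: the degree `n` piece is the
image of the `n`-th exterior power. -/
noncomputable def modelGrading (g n : ℕ) : Submodule ℚ (Model Γ g) :=
  (⋀[ℚ]^n (Generator Γ g →₀ ℚ)).map
    (RingQuot.mkAlgHom ℚ (fun a b : FreeModel Γ g => IsRelator a ∧ b = 0)).toLinearMap

end CurveArrangement

/-! A Koszul filtration is a family of left ideals generated in degree one and closed under
successive colon ideals. It produces linear resolutions: if the columns of a linear matrix have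
their colon ideals in the family, generators of these colon ideals are the leading coefficients of
linear syzygies, and these syzygies, ordered lexicographically, again have their colon ideals in the
family (`exists_koszul_syzygies`). It therefore suffices to find such a family containing the
augmentation ideal.

By Dirac's theorem (`exists_simplicial`) the vertices of a chordal graph can be added one at a time
so that the earlier neighbours of each new vertex form a clique. Simplicial vertices also shorten
cycles, so the Orlik-Solomon relations of all cycles follow from those of triangles
(`boundary_closedWalk`). The relations of the model are thus quadratic, and operators satisfying
them (a `LetterSystem`) give a representation of the model.

Adding a vertex `v` with clique `N` of earlier neighbours behaves like a fibration whose fibre is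
the curve minus points: over the submodel of the earlier vertices, a basis is `1`, `h a v`, `ω v`,
`γ v w` with `w ∈ N`. Spanning is rewriting by the relations (`IsStable.fiberSpan`); independence
comes from writing down the action on a sum of copies of a given representation (`extend`).
Iteration extends a representation from an initial segment to all vertices while keeping control of
annihilators (`exists_detecting_extension`).

The filtration consists of `0`, the ideals generated by all letters of an initial segment with last
vertex `v`, and the same ideals with one class `h c v` omitted. Starting from the ideal of the
earlier vertices, adjoin the `γ v w`, then the `h a v`. Each colon ideal is the full ideal of the
segment, except at the first class `h b v`: there the dual class `h b.conj v` is missing, because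
its product with `h b v` is a nonzero multiple of `ω v`, which is not yet in the ideal. One
inclusion for each colon ideal is a computation with the relations; the other evaluates on a small
representation by `mem_letterIdeal_of_mul_mem`. -/

/-! ### Koszul filtrations -/

section KoszulFiltration

variable {k : Type v} {A : Type u} [Field k] [Ring A] [Algebra k A]

/-- The colon ideals `(m j, j < i) : m i` of the family `m` all belong to `F`. -/
def HasColonsIn {M ι : Type*} [AddCommGroup M] [Module A M] [LT ι] (F : Set (Ideal A))
    (m : ι → M) : Prop :=
  ∀ i, ∃ I ∈ F, ∀ a : A, a • m i ∈ Submodule.span A (m '' {j | j < i}) ↔ a ∈ I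

/-- A family `F` of left ideals is a Koszul filtration if each member is generated by a finite
sequence of elements of degree one whose successive colon ideals are members of `F`. -/
def IsKoszulFiltration (𝒜 : ℕ → Submodule k A) (F : Set (Ideal A)) : Prop :=
  ∀ I ∈ F, ∃ (t : ℕ) (z : Fin t → A),
    Submodule.span A (Set.range z) = I ∧ (∀ i, z i ∈ 𝒜 1) ∧ HasColonsIn F z

/-- Since the columns are linear and `y` is quadratic, only the degree-one components of the
coefficients contribute; discarding the others keeps the value and does not enlarge the support. -/
theorem exists_linear_combination {κ ι : Type*} (𝒜 : ℕ → Submodule k A) [GradedRing 𝒜]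
    (m : ι → κ →₀ A) (hm : ∀ i c, m i c ∈ 𝒜 1) (s : Set ι) (y : κ →₀ A)
    (hy : ∀ c, y c ∈ 𝒜 2) (hys : y ∈ Submodule.span A (m '' s)) :
    ∃ b : ι →₀ A, (∀ i, b i ∈ 𝒜 1) ∧ (∀ i, i ∉ s → b i = 0) ∧
      Finsupp.linearCombination A m b = y := by
  classical
  obtain ⟨b, hb, rfl⟩ := (Finsupp.mem_span_image_iff_linearCombination A).1 hys
  refine ⟨b.mapRange (fun a => (DirectSum.decompose 𝒜 a 1 : A)) (by simp), fun i => by simp,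
    fun i hi => ?_, ?_⟩
  · have : b i = 0 := by
      by_contra h
      exact hi ((Finsupp.mem_supported _ _).1 hb (Finsupp.mem_support_iff.2 h))
    simp [this]
  · ext c
    have h2 : GradedRing.proj 𝒜 2 (Finsupp.linearCombination A m b c) =
        Finsupp.linearCombination A m b c := DirectSum.decompose_of_mem_same 𝒜 (hy c)
    rw [← h2, Finsupp.linearCombination_apply, Finsupp.linearCombination_apply,
      Finsupp.sum_mapRange_index (by simp)]
    simp only [Finsupp.sum, Finsupp.finsetSum_apply, Finsupp.smul_apply, smul_eq_mul, map_sum]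
    refine Finset.sum_congr rfl fun i _ => ?_
    exact (DirectSum.coe_decompose_mul_add_of_right_mem 𝒜 (i := 1) (hm i c)).symm

/-- A Gröbner-type argument. The leading coefficient at `i` of a syzygy lies in the colon ideal of
`m i`, and each generator `z i j` of that ideal lifts to a linear syzygy with leading term `z i j`
at `i`. These lifts generate by descending elimination of leading terms, and the colon ideal of the
lift `(i, j)` by its lexicographic predecessors is that of `z i j` by the `z i j'` with `j' < j`. -/
theorem exists_koszul_syzygies {κ ι : Type u} [LinearOrder ι] [Finite ι]
    (𝒜 : ℕ → Submodule k A) [GradedRing 𝒜] {F : Set (Ideal A)} (hF : IsKoszulFiltration 𝒜 F)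
    (m : ι → κ →₀ A) (hm : ∀ i c, m i c ∈ 𝒜 1) (hmF : HasColonsIn F m) :
    ∃ (ι' : Type u) (_ : LinearOrder ι') (_ : Finite ι') (s : ι' → ι →₀ A),
      (∀ i c, s i c ∈ 𝒜 1) ∧ HasColonsIn F s ∧
      Submodule.span A (Set.range s) = LinearMap.ker (Finsupp.linearCombination A m) := by
  classical
  choose I hIF hI using hmF
  choose t z hzI hz1 hzF using fun i => hF (I i) (hIF i)
  have hlift : ∀ i (j : Fin (t i)), ∃ b : ι →₀ A, (∀ l, b l ∈ 𝒜 1) ∧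
      (∀ l, l ∉ {l | l < i} → b l = 0) ∧ Finsupp.linearCombination A m b = z i j • m i := by
    intro i j
    refine exists_linear_combination 𝒜 m hm _ _ (fun c => ?_) ?_
    · exact SetLike.GradedMul.mul_mem (i := 1) (j := 1) (hz1 i j) (hm i c)
    · rw [hI, ← hzI]
      exact Submodule.subset_span ⟨j, rfl⟩
  choose b hb1 hb0 hb using hlift
  -- The correction `b` is supported strictly below `i`, so the coordinate at `i` is the leading one
  -- and equals `z i j`.
  let s : (Σₗ i, Fin (t i)) → ι →₀ A := fun p =>
    Finsupp.single (ofLex p).1 (z (ofLex p).1 (ofLex p).2) - b (ofLex p).1 (ofLex p).2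
  have hs_lt : ∀ p l, (ofLex p).1 < l → s p l = 0 := by
    intro p l hl
    simp [s, Finsupp.single_eq_of_ne hl.ne', hb0 _ _ l (not_lt.2 hl.le)]
  have hs_eq : ∀ p, s p (ofLex p).1 = z (ofLex p).1 (ofLex p).2 := by
    intro p
    simp [s, hb0 (ofLex p).1 (ofLex p).2 (ofLex p).1 (lt_irrefl _)]
  have hs_eq' : ∀ i j, s (toLex ⟨i, j⟩) i = z i j := fun i j => hs_eq (toLex ⟨i, j⟩)
  have hs_lt' : ∀ i j l, i < l → s (toLex ⟨i, j⟩) l = 0 := fun i j => hs_lt (toLex ⟨i, j⟩)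
  have hs_ker : ∀ p, Finsupp.linearCombination A m (s p) = 0 := by
    intro p
    simp [s, hb]
  have hspan_ker : ∀ S : Set (Σₗ i, Fin (t i)), ∀ x ∈ Submodule.span A (s '' S),
      Finsupp.linearCombination A m x = 0 := by
    intro S x hx
    rw [← LinearMap.mem_ker]
    refine Submodule.span_le.2 ?_ hx
    rintro _ ⟨p, -, rfl⟩
    exact hs_ker p
  -- the coordinate of a kernel element at its leading index lies in the colon ideal
  have hlead : ∀ (x : ι →₀ A) i, Finsupp.linearCombination A m x = 0 →
      (∀ l, i < l → x l = 0) → x i ∈ I i := by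
    intro x i hx hl
    rw [← hI]
    have h1 : x = Finsupp.single i (x i) + x.erase i := (Finsupp.single_add_erase i x).symm
    rw [h1, map_add, Finsupp.linearCombination_single] at hx
    rw [eq_neg_of_add_eq_zero_left hx]
    refine neg_mem ((Finsupp.mem_span_image_iff_linearCombination A).2 ⟨x.erase i, ?_, rfl⟩)
    refine (Finsupp.mem_supported _ _).2 fun l hl' => ?_
    simp only [Finsupp.support_erase, Finset.coe_erase, Set.mem_sdiff, Finset.mem_coe,
      Finsupp.mem_support_iff, Set.mem_singleton_iff] at hl'
    exact lt_of_le_of_ne (not_lt.1 fun h => hl'.1 (hl l h)) hl'.2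
  have hkill : ∀ i (J : Set (Fin (t i))) (a : A), a ∈ Submodule.span A (z i '' J) →
      ∃ y ∈ Submodule.span A (s '' {p | ∃ j ∈ J, p = toLex ⟨i, j⟩}), y i = a ∧
        ∀ l, i < l → y l = 0 := by
    intro i J a ha
    induction ha using Submodule.span_induction with
    | mem a ha =>
      obtain ⟨j, hj, rfl⟩ := ha
      exact ⟨s (toLex ⟨i, j⟩), Submodule.subset_span ⟨_, ⟨j, hj, rfl⟩, rfl⟩,
        hs_eq' i j, hs_lt' i j⟩
    | zero => exact ⟨0, zero_mem _, rfl, fun _ _ => rfl⟩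
    | add a a' _ _ h h' =>
      obtain ⟨y, hy, hya, hyl⟩ := h
      obtain ⟨y', hy', hya', hyl'⟩ := h'
      exact ⟨y + y', add_mem hy hy', by simp [hya, hya'], fun l hl => by
        simp [hyl l hl, hyl' l hl]⟩
    | smul c a _ h =>
      obtain ⟨y, hy, hya, hyl⟩ := h
      exact ⟨c • y, Submodule.smul_mem _ _ hy, by simp [hya], fun l hl => by simp [hyl l hl]⟩
  have hle : ∀ i (x : ι →₀ A), Finsupp.linearCombination A m x = 0 → (∀ l, i < l → x l = 0) →
      x ∈ Submodule.span A (s '' {p | (ofLex p).1 ≤ i}) := by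
    intro i
    induction i using WellFoundedLT.induction with
    | _ i ih =>
    intro x hx hl
    have h1 := hlead x i hx hl
    rw [← hzI, ← Set.image_univ] at h1
    -- A combination of syzygies of block `i` with the same leading coordinate as `x`; the
    -- difference has a smaller leading index.
    obtain ⟨y, hy, hyi, hyl⟩ := hkill i _ _ h1
    have hy' : y ∈ Submodule.span A (s '' {p | (ofLex p).1 ≤ i}) := by
      refine Submodule.span_mono (Set.image_mono ?_) hy
      rintro p ⟨j, -, rfl⟩
      exact le_rfl
    rw [← sub_add_cancel x y]
    refine add_mem ?_ hy'
    by_cases h0 : x - y = 0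
    · rw [h0]; exact zero_mem _
    have hne : (x - y).support.Nonempty := Finsupp.support_nonempty_iff.2 h0
    have hi' := Finset.max'_mem _ hne
    set i' := (x - y).support.max' hne
    have hgt : ∀ l, i' < l → (x - y) l = 0 := by
      intro l hl'
      by_contra h
      exact not_le.2 hl' (Finset.le_max' _ l (Finsupp.mem_support_iff.2 h))
    have hlt : i' < i := by
      rw [Finsupp.mem_support_iff] at hi'
      by_contra h
      rcases (not_lt.1 h).eq_or_lt with h | h
      · exact hi' (by rw [← h]; simp [hyi])
      · exact hi' (by simp [hl _ h, hyl _ h])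
    refine Submodule.span_mono (Set.image_mono ?_) (ih i' hlt (x - y) ?_ hgt)
    · exact fun p hp => le_trans hp hlt.le
    · rw [map_sub, hx, hspan_ker _ y hy, sub_zero]
  refine ⟨Σₗ i, Fin (t i), inferInstance, inferInstanceAs (Finite (Σ i, Fin (t i))), s, ?_, ?_, ?_⟩
  · intro p c
    refine sub_mem ?_ (hb1 _ _ _)
    rw [Finsupp.single_apply]
    split_ifs
    · exact hz1 _ _
    · exact zero_mem _
  · intro p
    obtain ⟨i, j⟩ := p
    obtain ⟨J, hJF, hJ⟩ := hzF i j
    refine ⟨J, hJF, fun a => (Iff.trans ?_ (hJ a))⟩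
    change a • s (toLex ⟨i, j⟩) ∈ Submodule.span A (s '' {q | q < toLex ⟨i, j⟩}) ↔ _
    have hlt_iff : ∀ q : Σₗ i, Fin (t i), q < toLex ⟨i, j⟩ ↔
        (ofLex q).1 < i ∨ ∃ j' < j, q = toLex ⟨i, j'⟩ := by
      rintro ⟨i', j'⟩
      refine Sigma.Lex.lt_def.trans ?_
      constructor
      · rintro (h | ⟨h, h'⟩)
        · exact Or.inl h
        · change i' = i at h
          subst h
          exact Or.inr ⟨j', h', rfl⟩
      · rintro (h | ⟨j'', h, h'⟩)
        · exact Or.inl h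
        · cases h'
          exact Or.inr ⟨rfl, h⟩
    constructor
    · intro h
      -- Syzygies of earlier blocks vanish at the coordinate `i`, so reading this coordinate only
      -- sees the predecessors inside block `i`.
      have hcoord : ∀ y ∈ Submodule.span A (s '' {q | q < toLex ⟨i, j⟩}),
          y i ∈ Submodule.span A (z i '' {j' | j' < j}) := by
        intro y hy
        induction hy using Submodule.span_induction with
        | mem y hy =>
          obtain ⟨q, hq, rfl⟩ := hy
          rcases (hlt_iff q).1 hq with h | ⟨j', h, rfl⟩
          · rw [hs_lt q i h]; exact zero_mem _
          · exact Submodule.subset_span ⟨j', h, (hs_eq (toLex ⟨i, j'⟩)).symm⟩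
        | zero => exact zero_mem _
        | add y y' _ _ h h' => exact add_mem h h'
        | smul c y _ h => exact Submodule.smul_mem _ c h
      have := hcoord _ h
      rwa [Finsupp.smul_apply, hs_eq'] at this
    · intro h
      obtain ⟨y, hy, hyi, hyl⟩ := hkill i _ _ h
      have hy' : y ∈ Submodule.span A (s '' {q | q < toLex ⟨i, j⟩}) := by
        refine Submodule.span_mono (Set.image_mono ?_) hy
        rintro _ ⟨j', h', rfl⟩
        exact (hlt_iff _).2 (Or.inr ⟨j', h', rfl⟩)
      rw [← sub_add_cancel (a • s (toLex ⟨i, j⟩)) y]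
      refine add_mem ?_ hy'
      set x := a • s (toLex ⟨i, j⟩) - y with hx
      have hx0 : ∀ l, i ≤ l → x l = 0 := by
        intro l hl
        rcases hl.eq_or_lt with rfl | hl
        · simp only [hx, Finsupp.sub_apply, Finsupp.smul_apply, hyi]
          rw [hs_eq', sub_self]
        · simp only [hx, Finsupp.sub_apply, Finsupp.smul_apply, hyl l hl]
          rw [hs_lt' i j l hl, smul_zero, sub_zero]
      have hxk : Finsupp.linearCombination A m x = 0 := by
        rw [hx, map_sub, map_smul, hs_ker, hspan_ker _ y hy, smul_zero, sub_zero]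
      by_cases h0 : x = 0
      · rw [h0]; exact zero_mem _
      have hne : x.support.Nonempty := Finsupp.support_nonempty_iff.2 h0
      have hi' := Finset.max'_mem _ hne
      set i' := x.support.max' hne
      have hlt : i' < i := by
        rw [Finsupp.mem_support_iff] at hi'
        by_contra h
        exact hi' (hx0 _ (not_lt.1 h))
      refine Submodule.span_mono (Set.image_mono ?_) (hle i' x hxk ?_)
      · exact fun q hq => (hlt_iff q).2 (Or.inl (lt_of_le_of_lt hq hlt))
      · intro l hl
        by_contra h
        exact not_le.2 hl (Finset.le_max' _ l (Finsupp.mem_support_iff.2 h))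
  · apply le_antisymm
    · rw [← Set.image_univ]
      exact fun x hx => LinearMap.mem_ker.2 (hspan_ker _ x hx)
    · intro x hx
      rw [LinearMap.mem_ker] at hx
      by_cases h0 : x = 0
      · rw [h0]; exact zero_mem _
      have hne : x.support.Nonempty := Finsupp.support_nonempty_iff.2 h0
      refine Submodule.span_mono (Set.image_subset_range _ _)
        (hle (x.support.max' hne) x hx fun l hl => ?_)
      by_contra h
      exact not_le.2 hl (Finset.le_max' _ l (Finsupp.mem_support_iff.2 h))

/-- A step of a linear resolution: a homomorphism of free modules given by a linear matrix whose
columns have their colon ideals in `F`. -/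
structure KoszulStage (𝒜 : ℕ → Submodule k A) (F : Set (Ideal A)) where
  target : Type u
  source : Type u
  order : LinearOrder source
  finite : Finite source
  column : source → target →₀ A
  column_mem : ∀ i c, column i c ∈ 𝒜 1
  colons : HasColonsIn F column

theorem KoszulStage.exists_next {𝒜 : ℕ → Submodule k A} [GradedRing 𝒜] {F : Set (Ideal A)}
    (hF : IsKoszulFiltration 𝒜 F) (S : KoszulStage 𝒜 F) :
    ∃ (ι' : Type u) (_ : LinearOrder ι') (_ : Finite ι') (s : ι' → S.source →₀ A),
      (∀ i c, s i c ∈ 𝒜 1) ∧ HasColonsIn F s ∧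
      Submodule.span A (Set.range s) = LinearMap.ker (Finsupp.linearCombination A S.column) :=
  letI := S.order
  haveI := S.finite
  exists_koszul_syzygies 𝒜 hF S.column S.column_mem S.colons

/-- The next step of the resolution. -/
noncomputable def KoszulStage.next {𝒜 : ℕ → Submodule k A} [GradedRing 𝒜] {F : Set (Ideal A)}
    (hF : IsKoszulFiltration 𝒜 F) (S : KoszulStage 𝒜 F) : KoszulStage 𝒜 F where
  target := S.source
  source := (S.exists_next hF).choose
  order := (S.exists_next hF).choose_spec.choose
  finite := (S.exists_next hF).choose_spec.choose_spec.choose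
  column := (S.exists_next hF).choose_spec.choose_spec.choose_spec.choose
  column_mem := (S.exists_next hF).choose_spec.choose_spec.choose_spec.choose_spec.1
  colons := (S.exists_next hF).choose_spec.choose_spec.choose_spec.choose_spec.2.1

theorem KoszulStage.span_range_next {𝒜 : ℕ → Submodule k A} [GradedRing 𝒜] {F : Set (Ideal A)}
    (hF : IsKoszulFiltration 𝒜 F) (S : KoszulStage 𝒜 F) :
    Submodule.span A (Set.range (S.next hF).column) =
      LinearMap.ker (Finsupp.linearCombination A S.column) :=
  (S.exists_next hF).choose_spec.choose_spec.choose_spec.choose_spec.2.2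

/-- The steps of the resolution. -/
noncomputable def KoszulStage.iterate {𝒜 : ℕ → Submodule k A} [GradedRing 𝒜]
    {F : Set (Ideal A)} (hF : IsKoszulFiltration 𝒜 F) (S : KoszulStage 𝒜 F) :
    ℕ → KoszulStage 𝒜 F
  | 0 => S
  | n + 1 => (KoszulStage.iterate hF S n).next hF

/-- The resolution starts with the linear generators of the augmentation ideal, as columns into a
free module of rank one; iterating the syzygy step stays linear and exact. -/
theorem IsKoszulFiltration.hasLinearFreeResolution {𝒜 : ℕ → Submodule k A} [GradedRing 𝒜]
    {F : Set (Ideal A)} (hF : IsKoszulFiltration 𝒜 F) (hA : augmentationIdeal 𝒜 ∈ F) :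
    HasLinearFreeResolution 𝒜 := by
  classical
  obtain ⟨t, z, hzI, hz1, hzF⟩ := hF _ hA
  let e : A →ₗ[A] (PUnit.{u + 1} →₀ A) := Finsupp.lsingle PUnit.unit
  have he : Function.Injective e := Finsupp.single_injective _
  have hmem : ∀ (a : A) (S : Set A),
      e a ∈ Submodule.span A (e '' S) ↔ a ∈ Submodule.span A S := by
    intro a S
    rw [← Submodule.map_span]
    exact ⟨fun ⟨b, hb, h⟩ => he h ▸ hb, fun h => ⟨a, h, rfl⟩⟩
  let S : KoszulStage 𝒜 F :=
    { target := PUnit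
      source := ULift (Fin t)
      order := LinearOrder.lift' ULift.down ULift.down_injective
      finite := inferInstance
      column := fun i => e (z i.down)
      column_mem := by
        rintro ⟨i⟩ ⟨⟩
        simpa [e] using hz1 i
      colons := by
        rintro ⟨i⟩
        obtain ⟨J, hJ, h⟩ := hzF i
        refine ⟨J, hJ, fun a => ?_⟩
        rw [← h a, ← hmem, map_smul]
        have : (fun i : ULift (Fin t) => e (z i.down)) '' {j | j.down < i} =
            e '' (z '' {j | j < i}) := by
          ext x
          constructor
          · rintro ⟨⟨j⟩, hj, rfl⟩
            exact ⟨_, ⟨j, hj, rfl⟩, rfl⟩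
          · rintro ⟨_, ⟨j, hj, rfl⟩, rfl⟩
            exact ⟨⟨j⟩, hj, rfl⟩
        rw [← this]
        rfl }
  let T := KoszulStage.iterate hF S
  let ε : (PUnit.{u + 1} →₀ A) →ₗ[A] A ⧸ augmentationIdeal 𝒜 :=
    (augmentationIdeal 𝒜).mkQ ∘ₗ Finsupp.lapply PUnit.unit
  have hε : ∀ a, ε (e a) = (augmentationIdeal 𝒜).mkQ a := fun a =>
    congrArg (augmentationIdeal 𝒜).mkQ (Finsupp.single_eq_same)
  refine ⟨fun n => (T n).target, ε,
    fun n => Finsupp.linearCombination A (T n).column, ?_, ?_, ?_, ?_⟩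
  · intro x
    obtain ⟨a, rfl⟩ := Submodule.mkQ_surjective _ x
    exact ⟨e a, hε a⟩
  · have h1 : Set.range S.column = e '' Set.range z := by
      ext x
      constructor
      · rintro ⟨⟨j⟩, rfl⟩
        exact ⟨_, ⟨j, rfl⟩, rfl⟩
      · rintro ⟨_, ⟨j, rfl⟩, rfl⟩
        exact ⟨⟨j⟩, rfl⟩
    have h2 : LinearMap.ker ε = LinearMap.range (Finsupp.linearCombination A S.column) := by
      rw [Finsupp.range_linearCombination, h1]
      ext x
      obtain ⟨a, rfl⟩ : ∃ a, e a = x :=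
        ⟨x PUnit.unit, Finsupp.ext fun _ => Finsupp.single_eq_same⟩
      rw [LinearMap.mem_ker, hmem, hzI, hε, Submodule.mkQ_apply, Submodule.Quotient.mk_eq_zero]
    exact LinearMap.exact_iff.2 h2
  · intro n
    have h2 : LinearMap.ker (Finsupp.linearCombination A (T n).column) =
        LinearMap.range (Finsupp.linearCombination A ((T n).next hF).column) := by
      rw [Finsupp.range_linearCombination, (T n).span_range_next hF]
    exact LinearMap.exact_iff.2 h2
  · intro n b c
    have h : ∀ b : (T n).source,
        Finsupp.linearCombination A (T n).column (Finsupp.single b 1) c ∈ 𝒜 1 := by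
      intro b
      rw [Finsupp.linearCombination_single, one_smul]
      exact (T n).column_mem b c
    exact h b

end KoszulFiltration

/-! ### Simplicial vertices of chordal graphs -/

namespace SimpleGraph

variable {V : Type u} {G : SimpleGraph V}

/-- A shortest walk has no chord: an edge joining two vertices that are not consecutive would give a
shortcut. -/
theorem Walk.mem_edges_of_length_eq_dist {a b : V} (p : G.Walk a b) (hp : p.length = G.dist a b)
    {x y : V} (hx : x ∈ p.support) (hy : y ∈ p.support) (hxy : G.Adj x y) :
    s(x, y) ∈ p.edges := by
  obtain ⟨i, rfl, hi⟩ := Walk.mem_support_iff_exists_getVert.1 hx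
  obtain ⟨j, rfl, hj⟩ := Walk.mem_support_iff_exists_getVert.1 hy
  clear hx hy
  have key : ∀ i j, i ≤ p.length → j ≤ p.length → i < j → G.Adj (p.getVert i) (p.getVert j) →
      s(p.getVert i, p.getVert j) ∈ p.edges := by
    intro i j hi hj hij h
    have h1 := G.dist_le (((p.take i).concat h).append (p.drop j))
    rw [Walk.length_append, Walk.length_concat, Walk.take_length, Walk.drop_length, ← hp] at h1
    obtain rfl : j = i + 1 := by omega
    exact (p.mk_mem_edges_iff_exists).2 ⟨i, by omega, rfl⟩
  rcases lt_trichotomy i j with h | h | h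
  · exact key i j hi hj h hxy
  · exact absurd (h ▸ hxy) (G.irrefl)
  · rw [Sym2.eq_swap]
    exact key j i hj hi h hxy.symm

/-- The vertices of `T` which are neither equal nor adjacent to `v`. -/
def awayFrom (G : SimpleGraph V) (T : Set V) (v : V) : Set V :=
  {x | x ∈ T ∧ x ≠ v ∧ ¬G.Adj v x}

/-- The connected component of `d` in the subgraph spanned by `K`. -/
def componentIn (G : SimpleGraph V) (K : Set V) (d : V) : Set V :=
  {x | Relation.ReflTransGen (fun a b => G.Adj a b ∧ b ∈ K) d x}

theorem self_mem_componentIn (K : Set V) (d : V) : d ∈ G.componentIn K d :=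
  Relation.ReflTransGen.refl

theorem componentIn_subset {K : Set V} {d : V} (hd : d ∈ K) : G.componentIn K d ⊆ K := by
  intro x hx
  induction hx with
  | refl => exact hd
  | tail _ h _ => exact h.2

theorem mem_componentIn_of_adj {K : Set V} {d x y : V} (hx : x ∈ G.componentIn K d)
    (h : G.Adj x y) (hy : y ∈ K) : y ∈ G.componentIn K d :=
  Relation.ReflTransGen.tail hx ⟨h, hy⟩

/-- Two nonadjacent neighbours of `v` which both have a neighbour in a component of the vertices
away from `v` give a cycle without chord. -/
theorem adj_of_boundary (hG : IsChordalGraph G) {T : Set V} {v d a b : V}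
    (hd : d ∈ G.awayFrom T v) (hva : G.Adj v a) (hvb : G.Adj v b) (hab : a ≠ b)
    (ha : ∃ c ∈ G.componentIn (G.awayFrom T v) d, G.Adj c a)
    (hb : ∃ c ∈ G.componentIn (G.awayFrom T v) d, G.Adj c b) : G.Adj a b := by
  classical
  by_contra hnab
  set C := G.componentIn (G.awayFrom T v) d with hC
  have hCK : ∀ x ∈ C, x ≠ v ∧ ¬G.Adj v x := fun x hx => (componentIn_subset hd hx).2
  -- A shortest path from `a` to `b` in the subgraph spanned by `D`, closed up through `v`, is a
  -- chordless cycle: `v` has no neighbours in `D` other than `a` and `b`, and nonadjacency of `a`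
  -- and `b` forces length at least four.
  let D : Set V := {x | x ∈ C ∨ x = a ∨ x = b}
  let H : SimpleGraph V :=
    { Adj := fun x y => G.Adj x y ∧ x ∈ D ∧ y ∈ D
      symm := ⟨fun x y h => ⟨h.1.symm, h.2.2, h.2.1⟩⟩
      loopless := ⟨fun x h => G.irrefl h.1⟩ }
  have hHG : H ≤ G := fun x y h => h.1
  have hreach : ∀ x ∈ C, H.Reachable d x := by
    intro x hx
    induction hx with
    | refl => exact Reachable.refl _
    | @tail y z hy h ih =>
      exact ih.trans (Adj.reachable
        ⟨h.1, Or.inl hy, Or.inl (mem_componentIn_of_adj (show y ∈ C from hy) h.1 h.2)⟩)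
  have hreach' : ∀ x, x ∈ D → (∃ c ∈ C, G.Adj c x) → H.Reachable d x := by
    rintro x hx ⟨c, hc, h⟩
    exact (hreach c hc).trans (Adj.reachable ⟨h, Or.inl hc, hx⟩)
  have hr : H.Reachable a b :=
    (hreach' a (Or.inr (Or.inl rfl)) ha).symm.trans (hreach' b (Or.inr (Or.inr rfl)) hb)
  obtain ⟨p, hpath, hlen⟩ := hr.exists_path_of_dist
  have hlen2 : 1 < p.length := by
    rw [hlen]
    exact hr.one_lt_dist_of_ne_of_not_adj hab fun h => hnab h.1
  have hsupp : ∀ x ∈ p.support, x ∈ D := by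
    intro x hx
    rcases Walk.mem_support_iff_exists_append.1 hx with ⟨q, r, -⟩
    cases q.reverse with
    | nil => exact Or.inr (Or.inl rfl)
    | cons h _ => exact h.2.1
  have hvD : v ∉ D := by
    rintro (h | h | h)
    · exact (hCK v h).1 rfl
    · exact G.irrefl (h ▸ hva)
    · exact G.irrefl (h ▸ hvb)
  let p' : G.Walk a b := p.mapLe hHG
  have hp's : p'.support = p.support := Walk.support_mapLe_eq_support hHG p
  have hp'e : p'.edges = p.edges := Walk.edges_mapLe_eq_edges hHG p
  let w : G.Walk v v := Walk.cons hva (p'.concat hvb.symm)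
  have hwe : ∀ e, e ∈ w.edges ↔ e = s(v, a) ∨ e ∈ p.edges ∨ e = s(b, v) := by
    intro e
    simp only [w, Walk.edges_cons, Walk.edges_concat, List.mem_cons, List.concat_eq_append,
      List.mem_append, hp'e, List.not_mem_nil, or_false]
  have hcyc : w.IsCycle := by
    rw [Walk.cons_isCycle_iff, Walk.concat_isPath_iff]
    refine ⟨⟨hpath.mapLe hHG, fun h => hvD (hsupp v (hp's ▸ h))⟩, ?_⟩
    rw [Walk.edges_concat, List.concat_eq_append, List.mem_append, hp'e]
    rintro (h | h)
    · exact hvD (hsupp v (Walk.fst_mem_support_of_mem_edges _ h))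
    · rw [List.mem_singleton, Sym2.eq_iff] at h
      rcases h with ⟨h, -⟩ | ⟨-, h⟩
      · exact G.irrefl (h ▸ hvb)
      · exact hab h
  have hws : ∀ x ∈ w.support, x = v ∨ x ∈ p.support := by
    intro x hx
    simp only [w, Walk.support_cons, Walk.support_concat, List.mem_cons, List.mem_append, hp's,
      List.not_mem_nil, or_false] at hx
    tauto
  have hv : ∀ x ∈ p.support, G.Adj v x → s(v, x) ∈ w.edges := by
    intro x hx h
    rw [hwe]
    rcases hsupp x hx with h' | rfl | rfl
    · exact absurd h (hCK x h').2
    · exact Or.inl rfl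
    · exact Or.inr (Or.inr Sym2.eq_swap)
  obtain ⟨x, hx, y, hy, hxy, hne⟩ := hG v w hcyc (by
    simp only [w, p', Walk.length_cons, Walk.length_concat, Walk.length_map, Walk.mapLe]
    omega)
  rcases hws x hx with rfl | hx' <;> rcases hws y hy with rfl | hy'
  · exact G.irrefl hxy
  · exact hne (hv y hy' hxy)
  · exact hne (Sym2.eq_swap ▸ hv x hx' hxy.symm)
  · refine hne ((hwe _).2 (Or.inr (Or.inl ?_)))
    exact p.mem_edges_of_length_eq_dist hlen hx' hy' ⟨hxy, hsupp x hx', hsupp y hy'⟩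

/-- Dirac's theorem: a nonempty finite set of vertices of a chordal graph has a vertex whose
neighbours in the set are pairwise adjacent. -/
theorem exists_simplicial (hG : IsChordalGraph G) (T : Finset V) (hT : T.Nonempty) :
    ∃ v ∈ T, ∀ x ∈ T, ∀ y ∈ T, G.Adj v x → G.Adj v y → x ≠ y → G.Adj x y := by
  classical
  by_cases hpair : ∃ q : V × V, q.1 ∈ T ∧ q.2 ∈ G.awayFrom T q.1
  swap
  · obtain ⟨v, hv⟩ := hT
    refine ⟨v, hv, fun x hx y hy _ _ hxy => ?_⟩
    by_contra h
    exact hpair ⟨(x, y), hx, hy, hxy.symm, h⟩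
  let C : V × V → Set V := fun q => G.componentIn (G.awayFrom T q.1) q.2
  -- Among all nonadjacent pairs in `T`, take one whose component is smallest. This component and
  -- its boundary `S` will turn out to form a clique containing all neighbours of `d` in `T`.
  obtain ⟨⟨v, d⟩, ⟨hvT, hd⟩, hmin⟩ := exists_minimalFor_of_wellFoundedLT
    (fun q : V × V => q.1 ∈ T ∧ q.2 ∈ G.awayFrom T q.1) (fun q => (C q).ncard) hpair
  have hCT : C (v, d) ⊆ T := fun x hx => (componentIn_subset hd hx).1
  have hout : ∀ c ∈ C (v, d), ∀ x ∈ T, G.Adj c x → x ∉ C (v, d) → G.Adj v x := by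
    intro c hc x hx hcx hxC
    by_contra h
    refine hxC (mem_componentIn_of_adj hc hcx ⟨hx, ?_, h⟩)
    rintro rfl
    exact (componentIn_subset hd hc).2.2 hcx.symm
  let S : Set V := {s | s ∈ T ∧ G.Adj v s ∧ ∃ c ∈ C (v, d), G.Adj c s}
  have hS : ∀ a ∈ S, ∀ b ∈ S, a ≠ b → G.Adj a b := fun a ha b hb hab =>
    adj_of_boundary hG hd ha.2.1 hb.2.1 hab ha.2.2 hb.2.2
  -- a vertex adjacent to all of `S` misses no vertex of the minimal component
  have hsub : ∀ s ∈ T, (∀ s' ∈ S, s' ∉ G.awayFrom T s) → ∀ e ∈ C (v, d), e ∈ G.awayFrom T s →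
      C (v, d) ⊆ G.awayFrom T s := by
    intro s hs hsS e he hes
    -- A path away from `s` cannot leave the component, since it would have to cross `S`; minimality
    -- then makes the two components equal.
    have h1 : C (s, e) ⊆ C (v, d) := by
      intro x hx
      induction hx with
      | refl => exact he
      | @tail y z _ h ih =>
        by_contra hz
        exact hsS z ⟨h.2.1, hout y ih z h.2.1 h.1 hz, y, ih, h.1⟩ h.2
    have hfin : (C (v, d)).Finite := T.finite_toSet.subset hCT
    have h2 : C (s, e) = C (v, d) := by
      refine Set.eq_of_subset_of_ncard_le h1 ?_ hfin
      exact hmin (j := (s, e)) ⟨hs, hes⟩ (Set.ncard_le_ncard h1 hfin)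
    rw [← h2]
    exact componentIn_subset hes
  have hSC : ∀ s ∈ S, ∀ e ∈ C (v, d), G.Adj s e := by
    intro s hs e he
    by_contra h
    have hes : e ∈ G.awayFrom T s := by
      refine ⟨hCT he, ?_, h⟩
      rintro rfl
      exact (componentIn_subset hd he).2.2 hs.2.1
    obtain ⟨c, hc, hcs⟩ := hs.2.2
    refine (hsub s hs.1 (fun s' hs' h' => ?_) e he hes hc).2.2 hcs.symm
    exact h'.2.2 (hS s hs s' hs' h'.2.1.symm)
  have hCC : ∀ c ∈ C (v, d), ∀ e ∈ C (v, d), c ≠ e → G.Adj c e := by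
    intro c hc e he hce
    by_contra h
    refine (hsub c (hCT hc) (fun s' hs' h' => ?_) e he ⟨hCT he, hce.symm, h⟩ hc).2.1 rfl
    exact h'.2.2 (hSC s' hs' c hc).symm
  have hdC : d ∈ C (v, d) := self_mem_componentIn _ _
  have hN : ∀ x ∈ T, G.Adj d x → x ∈ C (v, d) ∨ x ∈ S := by
    intro x hx h
    by_cases hxC : x ∈ C (v, d)
    · exact Or.inl hxC
    · exact Or.inr ⟨hx, hout d hdC x hx h hxC, d, hdC, h⟩
  refine ⟨d, hCT hdC, fun x hx y hy hdx hdy hxy => ?_⟩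
  rcases hN x hx hdx with hx | hx <;> rcases hN y hy hdy with hy | hy
  · exact hCC x hx y hy hxy
  · exact (hSC y hy x hx).symm
  · exact hSC x hx y hy
  · exact hS x hx y hy hxy

/-- The vertices of the list `l` are added to the set `T` one after the other, and the neighbours
of each one among the previous vertices are pairwise adjacent. -/
def IsElimination [DecidableEq V] (G : SimpleGraph V) : Finset V → List V → Prop
  | _, [] => True
  | T, v :: l => v ∉ T ∧
      (∀ x ∈ T, ∀ y ∈ T, G.Adj v x → G.Adj v y → x ≠ y → G.Adj x y) ∧
      IsElimination G (insert v T) l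

theorem IsElimination.append_singleton [DecidableEq V] {T : Finset V} {l : List V}
    (h : IsElimination G T l) {v : V} (hv : v ∉ T) (hvl : v ∉ l)
    (hadj : ∀ x, x ∈ T ∨ x ∈ l → ∀ y, y ∈ T ∨ y ∈ l →
      G.Adj v x → G.Adj v y → x ≠ y → G.Adj x y) :
    IsElimination G T (l ++ [v]) := by
  induction l generalizing T with
  | nil =>
    exact ⟨hv, fun x hx y hy => hadj x (Or.inl hx) y (Or.inl hy), trivial⟩
  | cons u l ih =>
    rw [List.mem_cons, not_or] at hvl
    refine ⟨h.1, h.2.1, ih h.2.2 ?_ hvl.2 fun x hx y hy => hadj x ?_ y ?_⟩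
    · simp [hv, hvl.1]
    · simpa [or_assoc, or_left_comm] using hx
    · simpa [or_assoc, or_left_comm] using hy

/-- A simplicial vertex is placed last, and the remaining vertices are ordered by induction. -/
theorem exists_isElimination [DecidableEq V] (hG : IsChordalGraph G) (T : Finset V) :
    ∃ l : List V, (∀ v, v ∈ l ↔ v ∈ T) ∧ IsElimination G ∅ l := by
  induction T using Finset.strongInduction with
  | H T ih =>
    rcases T.eq_empty_or_nonempty with rfl | hT
    · exact ⟨[], by simp, trivial⟩
    obtain ⟨v, hv, hadj⟩ := exists_simplicial hG T hT
    obtain ⟨l, hl, he⟩ := ih (T.erase v) (Finset.erase_ssubset hv)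
    refine ⟨l ++ [v], fun x => ?_, he.append_singleton (by simp) (by simp [hl]) ?_⟩
    · by_cases h : x = v <;> simp [hl, h, hv]
    · intro x hx y hy
      simp only [Finset.notMem_empty, false_or, hl, Finset.mem_erase] at hx hy
      exact hadj x hx.2 y hy.2

end SimpleGraph

/-! ### Orlik-Solomon relations of closed walks -/

section Boundary

variable {α : Type*} {R : Type*} [Ring R]

/-- The sum `∑ⱼ (-1)ʲ f a₀ ⋯ (omit f aⱼ) ⋯ f aₙ`. -/
def boundary (f : α → R) : List α → R
  | [] => 0
  | a :: l => (l.map f).prod - f a * boundary f l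

theorem map_boundary {S : Type*} [Ring S] (φ : R →+* S) (f : α → R) (l : List α) :
    φ (boundary f l) = boundary (fun a => φ (f a)) l := by
  induction l with
  | nil => exact map_zero φ
  | cons a l ih => simp [boundary, ih, map_list_prod, Function.comp_def]

theorem boundary_map {β : Type*} (f : α → R) (e : β → α) (l : List β) :
    boundary f (l.map e) = boundary (fun b => f (e b)) l := by
  induction l with
  | nil => rfl
  | cons a l ih => simp [boundary, ih, Function.comp_def]

theorem boundary_cons_cons (f : α → R) (a b : α) (l : List α) :
    boundary f (a :: b :: l) =
      f b * (l.map f).prod - f a * (l.map f).prod + f a * f b * boundary f l := by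
  simp only [boundary, List.map_cons, List.prod_cons]
  noncomm_ring

/-- A transposition of anticommuting factors changes the sign of both the product and the boundary.
The two must be carried along with a common sign, because the recursion for the boundary involves
the product. -/
theorem boundary_perm {f : α → R} (hf : ∀ a b, f a * f b = -(f b * f a)) {l l' : List α}
    (h : l.Perm l') :
    ((l.map f).prod = (l'.map f).prod ∧ boundary f l = boundary f l') ∨
      ((l.map f).prod = -(l'.map f).prod ∧ boundary f l = -boundary f l') := by
  induction h with
  | nil => simp
  | cons a _ ih =>
    rcases ih with ⟨h1, h2⟩ | ⟨h1, h2⟩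
    · left
      simp [boundary, h1, h2]
    · right
      constructor
      · simp [h1]
      · simp only [boundary, h1, h2]
        noncomm_ring
  | swap a b l =>
    right
    constructor
    · simp only [List.map_cons, List.prod_cons, ← mul_assoc]
      rw [hf b a, neg_mul]
    · rw [boundary_cons_cons, boundary_cons_cons, hf b a]
      noncomm_ring
  | trans _ _ ih ih' =>
    rcases ih with ⟨h1, h2⟩ | ⟨h1, h2⟩ <;> rcases ih' with ⟨h3, h4⟩ | ⟨h3, h4⟩ <;>
      simp [h1, h2, h3, h4]

theorem boundary_eq_zero_of_perm {f : α → R} (hf : ∀ a b, f a * f b = -(f b * f a))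
    {l l' : List α} (h : l.Perm l') (hl : boundary f l = 0) : boundary f l' = 0 := by
  rcases boundary_perm hf h with ⟨-, h⟩ | ⟨-, h⟩
  · rw [← h, hl]
  · rw [← neg_eq_zero, ← h, hl]

end Boundary

/-! ### Letter systems: quadratic relations and representations of the model. -/

namespace CurveArrangement

variable {V : Type u}

/-- The index set of the generators `x i`, `y i` of one vertex: `(false, i)` stands for `x i` and
`(true, i)` for `y i`. -/
abbrev FormIndex (g : ℕ) : Type := Bool × Fin g

/-- The index of the dual class. -/
def FormIndex.conj {g : ℕ} (a : FormIndex g) : FormIndex g := (!a.1, a.2)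

@[simp] theorem FormIndex.conj_conj {g : ℕ} (a : FormIndex g) : a.conj.conj = a := by
  simp [conj]

theorem FormIndex.conj_ne {g : ℕ} (a : FormIndex g) : a.conj ≠ a := by
  intro h
  simpa [conj] using congrArg Prod.fst h

/-- The intersection form on the first cohomology of the curve. -/
def pairing {g : ℕ} (a b : FormIndex g) : ℚ :=
  if b = a.conj then (if a.1 then -1 else 1) else 0

theorem pairing_swap {g : ℕ} (a b : FormIndex g) : pairing a b = -pairing b a := by
  obtain ⟨s, i⟩ := a
  obtain ⟨t, j⟩ := b
  cases s <;> cases t <;> by_cases h : i = j <;>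
    simp [pairing, FormIndex.conj, h, eq_comm]

theorem pairing_of_ne {g : ℕ} {a b : FormIndex g} (h : b ≠ a.conj) : pairing a b = 0 :=
  if_neg h

theorem pairing_conj_ne_zero {g : ℕ} (a : FormIndex g) : pairing a a.conj ≠ 0 := by
  rw [pairing, if_pos rfl]
  split_ifs <;> norm_num

/-- Elements `h a v`, `ω v` and `γ u v` of a ring which satisfy the quadratic relations of the
model: `h a v` are the classes of degree one of the curve at the vertex `v`, `ω v` is the class of
a point and `γ u v` is the class of the edge `uv`. -/
structure LetterSystem (Γ : SimpleGraph V) (g : ℕ) (R : Type*) [Ring R] [Algebra ℚ R] where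
  h : FormIndex g → V → R
  ω : V → R
  γ : V → V → R
  γ_symm : ∀ u v, γ u v = γ v u
  γ_of_not_adj : ∀ u v, ¬Γ.Adj u v → γ u v = 0
  h_anticomm : ∀ a u b v, h a u * h b v = -(h b v * h a u)
  γ_mul_h : ∀ u v a w, γ u v * h a w = -(h a w * γ u v)
  γ_anticomm : ∀ u v u' v', γ u v * γ u' v' = -(γ u' v' * γ u v)
  h_mul_h : ∀ a b v, h a v * h b v = pairing a b • ω v
  h_mul_γ : ∀ a u v, h a u * γ u v = h a v * γ u v
  triangle : ∀ u v w, Γ.Adj u v → Γ.Adj v w → Γ.Adj w u →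
    γ u v * γ v w + γ v w * γ w u + γ w u * γ u v = 0

namespace LetterSystem

variable {Γ : SimpleGraph V} {g : ℕ} {R : Type*} [Ring R] [Algebra ℚ R]
  (L : LetterSystem Γ g R)

/-- The class of an edge. -/
def edge : Sym2 V → R := Sym2.lift ⟨L.γ, L.γ_symm⟩

@[simp] theorem edge_mk (u v : V) : L.edge s(u, v) = L.γ u v := rfl

theorem edge_anticomm (e e' : Sym2 V) : L.edge e * L.edge e' = -(L.edge e' * L.edge e) := by
  induction e with | _ u v
  induction e' with | _ u' v'
  exact L.γ_anticomm u v u' v'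

theorem sq_eq_zero_of_anticomm {z : R} (h : z * z = -(z * z)) : z * z = 0 := by
  have : (2 : ℚ) • (z * z) = 0 := by
    rw [two_smul]
    nth_rewrite 1 [h]
    exact neg_add_cancel _
  simpa using this

theorem h_sq (a : FormIndex g) (v : V) : L.h a v * L.h a v = 0 :=
  sq_eq_zero_of_anticomm (L.h_anticomm a v a v)

theorem γ_sq (u v : V) : L.γ u v * L.γ u v = 0 :=
  sq_eq_zero_of_anticomm (L.γ_anticomm u v u v)

theorem γ_self (v : V) : L.γ v v = 0 := L.γ_of_not_adj v v Γ.irrefl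

/-- Induction on the length, for closed walks rather than cycles, so that shortcuts need not be
simple. At a vertex `v` that is simplicial in the support, the two neighbours on the walk either
coincide or are adjacent; the walk is shortened there at the cost of a triangle relation. -/
theorem boundary_closedWalk (hΓ : IsChordalGraph Γ) {u : V} (c : Γ.Walk u u) :
    boundary L.edge c.edges = 0 := by
  classical
  induction hn : c.length using Nat.strong_induction_on generalizing u with
  | _ n ih =>
  obtain ⟨v, hv, hadj⟩ := SimpleGraph.exists_simplicial hΓ c.support.toFinset
    ⟨u, by simp⟩
  rw [List.mem_toFinset] at hv
  have hlen : (c.rotate v hv).length = n := by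
    rw [← hn, ← SimpleGraph.Walk.length_edges, ← SimpleGraph.Walk.length_edges]
    exact (c.rotate_edges v hv).perm.length_eq
  refine boundary_eq_zero_of_perm L.edge_anticomm (c.rotate_edges v hv).perm ?_
  have hsub : ∀ x y, s(x, y) ∈ (c.rotate v hv).edges → x ∈ c.support := fun x y h =>
    SimpleGraph.Walk.fst_mem_support_of_mem_edges _ ((c.rotate_edges v hv).perm.subset h)
  generalize c.rotate v hv = c' at hlen hsub ⊢
  cases c' with
  | nil => rfl
  | @cons _ x _ hvx p =>
    cases p with
    | nil => exact absurd hvx Γ.irrefl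
    | cons h2 p =>
    obtain ⟨y, q, hyv, he⟩ := SimpleGraph.Walk.exists_cons_eq_concat h2 p
    rw [he] at hlen hsub ⊢
    simp only [SimpleGraph.Walk.length_cons, SimpleGraph.Walk.length_concat] at hlen
    have hx : x ∈ c.support := hsub x v (by simp [Sym2.eq_swap])
    have hy : y ∈ c.support := hsub y v (by simp [SimpleGraph.Walk.edges_concat])
    have hperm : (s(v, x) :: s(y, v) :: q.edges).Perm
        (SimpleGraph.Walk.cons hvx (q.concat hyv)).edges := by
      rw [SimpleGraph.Walk.edges_cons, SimpleGraph.Walk.edges_concat, List.concat_eq_append]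
      exact (List.perm_append_singleton _ _).symm.cons _
    refine boundary_eq_zero_of_perm L.edge_anticomm hperm ?_
    rw [boundary_cons_cons]
    by_cases hxy : x = y
    -- A backtrack at `v`: its two edges coincide, so the first two terms of the expansion cancel,
    -- and what is left of the walk is closed and shorter.
    · subst hxy
      rw [ih q.length (by omega) q rfl, edge_mk, edge_mk, L.γ_symm x v]
      simp
    · have hxy' := hadj x (by simpa using hx) y (by simpa using hy) hvx hyv.symm hxy
      have h1 := ih (q.length + 1) (by omega) (SimpleGraph.Walk.cons hxy'.symm q) rfl
      -- The relation of the shortened walk expresses the product over `q` as the class of `y x`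
      -- times the boundary of `q`. The whole boundary becomes the triangle relation times the
      -- boundary of `q`.
      rw [SimpleGraph.Walk.edges_cons, boundary, sub_eq_zero] at h1
      rw [h1, edge_mk, edge_mk, edge_mk]
      have h2 := L.triangle v x y hvx hxy' hyv
      have h3 : L.γ y v * L.γ y x - L.γ v x * L.γ y x + L.γ v x * L.γ y v = 0 := by
        rw [← neg_eq_zero, ← h2, L.γ_symm y x, L.γ_anticomm y v x y, L.γ_anticomm v x y v]
        abel
      calc _ = (L.γ y v * L.γ y x - L.γ v x * L.γ y x + L.γ v x * L.γ y v) *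
            boundary L.edge q.edges := by noncomm_ring
        _ = 0 := by rw [h3, zero_mul]

theorem linearCombination_mul_self {ι : Type*} {z : ι → R} (hz : ∀ i j, z i * z j = -(z j * z i))
    (m : ι →₀ ℚ) :
    Finsupp.linearCombination ℚ z m * Finsupp.linearCombination ℚ z m = 0 := by
  have key : ∀ m m' : ι →₀ ℚ,
      Finsupp.linearCombination ℚ z m * Finsupp.linearCombination ℚ z m' =
        -(Finsupp.linearCombination ℚ z m' * Finsupp.linearCombination ℚ z m) := by
    intro m m'
    induction m using Finsupp.induction_linear with
    | zero => simp
    | add p q hp hq => rw [map_add, add_mul, mul_add, hp, hq, neg_add]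
    | single i r =>
      induction m' using Finsupp.induction_linear with
      | zero => simp
      | add p q hp hq => rw [map_add, add_mul, mul_add, hp, hq, neg_add]
      | single j s =>
        rw [Finsupp.linearCombination_single, Finsupp.linearCombination_single,
          smul_mul_smul_comm, smul_mul_smul_comm, hz i j, smul_neg, mul_comm]
  exact sq_eq_zero_of_anticomm (key m m)

theorem h_mul_h_of_ne {a b : FormIndex g} (hab : b ≠ a.conj) (v : V) :
    L.h a v * L.h b v = 0 := by
  rw [L.h_mul_h, pairing_of_ne hab, zero_smul]

theorem h_mul_γ_anticomm (a : FormIndex g) (u v w : V) :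
    L.h a u * L.γ v w = -(L.γ v w * L.h a u) := by
  rw [L.γ_mul_h, neg_neg]

/-- The value of a letter system at a generator. -/
def value : Generator Γ g → R
  | .x i v => L.h (false, i) v
  | .y i v => L.h (true, i) v
  | .edge e => L.edge e.1

theorem value_anticomm (s t : Generator Γ g) :
    L.value s * L.value t = -(L.value t * L.value s) := by
  have h1 : ∀ (e : Sym2 V) a u, L.edge e * L.h a u = -(L.h a u * L.edge e) := by
    intro e a u
    induction e with | _ v w
    exact L.γ_mul_h v w a u
  cases s <;> cases t <;> simp only [value, h1, neg_neg] <;>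
    first | exact L.h_anticomm _ _ _ _ | exact L.edge_anticomm _ _

/-- The evaluation of the exterior algebra at a letter system. -/
noncomputable def eval : FreeModel Γ g →ₐ[ℚ] R :=
  ExteriorAlgebra.lift ℚ ⟨Finsupp.linearCombination ℚ L.value,
    linearCombination_mul_self L.value_anticomm⟩

@[simp] theorem eval_gen (s : Generator Γ g) : L.eval (gen s) = L.value s := by
  simp [eval, gen]

theorem _root_.CurveArrangement.orlikSolomonElement_eq (l : List Γ.edgeSet) :
    orlikSolomonElement (g := g) l = -boundary E l := by
  induction l with
  | nil => simp [orlikSolomonElement, boundary]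
  | cons e l ih =>
    have h1 : boundary E l = -orlikSolomonElement (g := g) l := by rw [ih, neg_neg]
    have h2 : ∀ j (z : FreeModel Γ g), (-1) ^ (j + 1 + 1) * (E e * z) =
        -(E e * ((-1) ^ (j + 1) * z)) := by
      intro j z
      rw [pow_succ, mul_neg_one, neg_mul, ← mul_assoc, ← mul_assoc,
        ((Commute.neg_one_left (E e)).pow_left (j + 1)).eq]
    rw [boundary, h1, orlikSolomonElement, List.length_cons, Finset.sum_range_succ',
      orlikSolomonElement]
    simp only [List.eraseIdx_cons_succ, List.map_cons, List.prod_cons, h2, Finset.sum_neg_distrib,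
      ← Finset.mul_sum, List.eraseIdx_zero, List.tail_cons]
    noncomm_ring

section Lift

variable [LinearOrder V]

theorem _root_.CurveArrangement.edge_eq_head_tail (e : Γ.edgeSet) : e.1 = s(head e, tail e) := by
  obtain ⟨e, he⟩ := e
  induction e with | _ a b
  simp only [head, tail, Sym2.sup_mk, Sym2.inf_mk]
  rcases le_total a b with h | h <;> simp [h, Sym2.eq_swap]

/-- All relators but the Orlik-Solomon ones are quadratic relations of a letter system up to
rewriting; chordality enters through `boundary_closedWalk`. -/
theorem eval_relator (hΓ : IsChordalGraph Γ) {r : FreeModel Γ g} (hr : IsRelator r) :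
    L.eval r = 0 := by
  have hx : ∀ i v, L.eval (X i v) = L.h (false, i) v := fun i v => L.eval_gen _
  have hy : ∀ i v, L.eval (Y i v) = L.h (true, i) v := fun i v => L.eval_gen _
  have hE : ∀ e, L.eval (E e) = L.edge e.1 := fun e => L.eval_gen _
  cases hr with
  | orlikSolomon l hl =>
    obtain ⟨hsort, v, w, hw, hmem⟩ := hl
    rw [orlikSolomonElement_eq, map_neg, neg_eq_zero]
    have h1 : L.eval (boundary E l) = boundary L.edge (l.map Subtype.val) := by
      rw [boundary_map]
      refine (map_boundary L.eval.toRingHom E l).trans ?_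
      congr 1
      exact funext hE
    rw [h1]
    refine boundary_eq_zero_of_perm L.edge_anticomm ?_ (L.boundary_closedWalk hΓ w)
    refine (List.perm_ext_iff_of_nodup hw.edges_nodup ?_).2 fun e => ?_
    · refine List.Nodup.map Subtype.val_injective ?_
      refine hsort.imp ?_
      rintro e _ h rfl
      rcases h with h | ⟨-, h⟩ <;> exact lt_irrefl _ h
    · rw [List.mem_map]
      constructor
      · intro h
        exact ⟨⟨e, w.edges_subset_edgeSet h⟩, (hmem _).2 h, rfl⟩
      · rintro ⟨e, he, rfl⟩
        exact (hmem e).1 he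
  | diagonal_x i e =>
    rw [map_mul, map_sub, hx, hx, hE, edge_eq_head_tail, edge_mk, sub_mul, sub_eq_zero]
    exact L.h_mul_γ _ _ _
  | diagonal_y i e =>
    rw [map_mul, map_sub, hy, hy, hE, edge_eq_head_tail, edge_mk, sub_mul, sub_eq_zero]
    exact L.h_mul_γ _ _ _
  | x_mul_y i j hij v =>
    rw [map_mul, hx, hy]
    exact L.h_mul_h_of_ne (by simp [FormIndex.conj, hij.symm]) v
  | x_mul_x i j hij v =>
    rw [map_mul, hx, hx]
    exact L.h_mul_h_of_ne (by simp [FormIndex.conj]) v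
  | y_mul_y i j hij v =>
    rw [map_mul, hy, hy]
    exact L.h_mul_h_of_ne (by simp [FormIndex.conj]) v
  | point_class i j v =>
    rw [map_sub, map_mul, map_mul, hx, hy, hx, hy, L.h_mul_h, L.h_mul_h]
    simp [pairing, FormIndex.conj]

/-- The representation of the model given by a letter system. -/
noncomputable def lift (hΓ : IsChordalGraph Γ) : Model Γ g →ₐ[ℚ] R :=
  RingQuot.liftAlgHom ℚ ⟨L.eval, fun a b h => by rw [L.eval_relator hΓ h.1, h.2, map_zero]⟩

theorem lift_mk (hΓ : IsChordalGraph Γ) (s : Generator Γ g) :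
    L.lift hΓ (RingQuot.mkAlgHom ℚ _ (gen s)) = L.value s := by
  simp [lift]

end Lift

end LetterSystem

theorem gen_anticomm {Γ : SimpleGraph V} {g : ℕ} (s t : Generator Γ g) :
    gen s * gen t = -(gen t * gen s) :=
  eq_neg_of_add_eq_zero_left (ExteriorAlgebra.ι_add_mul_swap _ _)

/-! ### The model as a letter system. -/

section Model

variable [LinearOrder V] (Γ : SimpleGraph V) (g : ℕ)

/-- The projection of the exterior algebra onto the model. -/
noncomputable abbrev toModel : FreeModel Γ g →ₐ[ℚ] Model Γ g :=
  RingQuot.mkAlgHom ℚ (fun a b : FreeModel Γ g => IsRelator a ∧ b = 0)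

variable {Γ g}

theorem toModel_relator {r : FreeModel Γ g} (hr : IsRelator r) : toModel Γ g r = 0 := by
  rw [RingQuot.mkAlgHom_rel ℚ ⟨hr, rfl⟩, map_zero]

theorem toModel_anticomm (s t : Generator Γ g) :
    toModel Γ g (gen s) * toModel Γ g (gen t) =
      -(toModel Γ g (gen t) * toModel Γ g (gen s)) := by
  rw [← map_mul, gen_anticomm, map_neg, map_mul]

/-- The generator of an element of the index set of the classes of degree one. -/
def FormIndex.generator (a : FormIndex g) (v : V) : Generator Γ g :=
  if a.1 then .y a.2 v else .x a.2 v

open scoped Classical in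
/-- The image in the model of the generator of an edge. -/
noncomputable def modelEdge (g : ℕ) (u v : V) : Model Γ g :=
  if h : Γ.Adj u v then toModel Γ g (E ⟨s(u, v), h⟩) else 0

theorem modelEdge_of_adj {u v : V} (h : Γ.Adj u v) :
    modelEdge g u v = toModel Γ g (E ⟨s(u, v), h⟩) := dif_pos h

theorem modelEdge_of_not_adj {u v : V} (h : ¬Γ.Adj u v) : modelEdge (Γ := Γ) g u v = 0 :=
  dif_neg h

theorem modelEdge_symm (u v : V) : modelEdge (Γ := Γ) g u v = modelEdge g v u := by
  by_cases h : Γ.Adj u v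
  · rw [modelEdge_of_adj h, modelEdge_of_adj h.symm]
    simp only [Sym2.eq_swap]
  · rw [modelEdge_of_not_adj h, modelEdge_of_not_adj fun h' => h h'.symm]

theorem modelEdge_anticomm (u v u' v' : V) :
    modelEdge (Γ := Γ) g u v * modelEdge g u' v' = -(modelEdge g u' v' * modelEdge g u v) := by
  by_cases h : Γ.Adj u v
  · by_cases h' : Γ.Adj u' v'
    · rw [modelEdge_of_adj h, modelEdge_of_adj h']
      exact toModel_anticomm _ _
    · simp [modelEdge_of_not_adj h']
  · simp [modelEdge_of_not_adj h]

theorem modelEdge_triangle_of_lt {u v w : V} (huv : u < v) (hvw : v < w) (h1 : Γ.Adj u v)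
    (h2 : Γ.Adj v w) (h3 : Γ.Adj w u) :
    modelEdge (Γ := Γ) g u v * modelEdge g v w + modelEdge g v w * modelEdge g w u +
      modelEdge g w u * modelEdge g u v = 0 := by
  -- The heads of these edges are `v`, `w`, `w`, and the last two are ordered by their tails `u <
  -- v`.
  have h : IsOrderedCycle (Γ := Γ) [⟨s(u, v), h1⟩, ⟨s(u, w), h3.symm⟩, ⟨s(v, w), h2⟩] := by
    have huw := huv.trans hvw
    constructor
    · simp [EdgeLT, head, tail, huv, hvw, huv.le, hvw.le, huw.le]
    · refine ⟨u, .cons h1 (.cons h2 (.cons h3 .nil)), ?_, ?_⟩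
      · rw [SimpleGraph.Walk.cons_isCycle_iff]
        simp [h1.ne, h2.ne, h3.ne, h1.ne', h3.ne']
      · rintro ⟨e, he⟩
        simp only [List.mem_cons, Subtype.ext_iff, List.not_mem_nil, or_false,
          SimpleGraph.Walk.edges_cons, SimpleGraph.Walk.edges_nil, Sym2.eq_swap (a := w) (b := u)]
        tauto
  have h4 := toModel_relator (g := g) (.orlikSolomon _ h)
  rw [orlikSolomonElement_eq] at h4
  simp only [boundary, List.map_cons, List.map_nil, List.prod_cons, List.prod_nil, mul_one,
    mul_zero, sub_zero, map_neg, map_sub, map_mul, ← modelEdge_of_adj h1,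
    ← modelEdge_of_adj h3.symm, ← modelEdge_of_adj h2, neg_eq_zero] at h4
  rw [modelEdge_symm w u, modelEdge_anticomm v w u w, modelEdge_anticomm u w u v]
  rw [← neg_eq_zero, ← h4, mul_sub]
  abel

/-- The relation is invariant under rotation and, up to sign, under reversal of the triangle, so the
vertices may be put in increasing order. -/
theorem modelEdge_triangle (u v w : V) (h1 : Γ.Adj u v) (h2 : Γ.Adj v w) (h3 : Γ.Adj w u) :
    modelEdge (Γ := Γ) g u v * modelEdge g v w + modelEdge g v w * modelEdge g w u +
      modelEdge g w u * modelEdge g u v = 0 := by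
  have rot : ∀ {u v w : V}, modelEdge (Γ := Γ) g u v * modelEdge g v w +
      modelEdge g v w * modelEdge g w u + modelEdge g w u * modelEdge g u v = 0 →
      modelEdge (Γ := Γ) g v w * modelEdge g w u + modelEdge g w u * modelEdge g u v +
      modelEdge g u v * modelEdge g v w = 0 := by
    intro u v w h
    rw [← h]
    abel
  have flip : ∀ {u v w : V}, modelEdge (Γ := Γ) g u v * modelEdge g v w +
      modelEdge g v w * modelEdge g w u + modelEdge g w u * modelEdge g u v = 0 →
      modelEdge (Γ := Γ) g w v * modelEdge g v u + modelEdge g v u * modelEdge g u w +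
      modelEdge g u w * modelEdge g w v = 0 := by
    intro u v w h
    rw [modelEdge_symm w v, modelEdge_symm v u, modelEdge_symm u w,
      modelEdge_anticomm v w u v, modelEdge_anticomm u v w u, modelEdge_anticomm w u v w,
      ← neg_eq_zero, ← h]
    abel
  rcases h1.ne.lt_or_gt with huv | huv <;> rcases h2.ne.lt_or_gt with hvw | hvw <;>
    rcases h3.ne.lt_or_gt with hwu | hwu
  · exact absurd (huv.trans hvw) hwu.not_gt
  · exact modelEdge_triangle_of_lt huv hvw h1 h2 h3
  · exact rot (modelEdge_triangle_of_lt hwu huv h3 h1 h2)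
  · exact rot (rot (flip (modelEdge_triangle_of_lt hwu hvw h3.symm h2.symm h1.symm)))
  · exact rot (rot (modelEdge_triangle_of_lt hvw hwu h2 h3 h1))
  · exact rot (flip (modelEdge_triangle_of_lt huv hwu h1.symm h3.symm h2.symm))
  · exact flip (modelEdge_triangle_of_lt hvw huv h2.symm h1.symm h3.symm)
  · exact absurd (hvw.trans huv) hwu.not_gt

theorem toModel_generator_mul_modelEdge (a : FormIndex g) (u v : V) :
    toModel Γ g (gen (a.generator u)) * modelEdge g u v =
      toModel Γ g (gen (a.generator v)) * modelEdge g u v := by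
  by_cases h : Γ.Adj u v
  swap
  · simp [modelEdge_of_not_adj h]
  rw [modelEdge_of_adj h]
  have key : ∀ e : Γ.edgeSet, toModel Γ g (gen (a.generator (head e))) * toModel Γ g (E e) =
      toModel Γ g (gen (a.generator (tail e))) * toModel Γ g (E e) := by
    intro e
    rw [← sub_eq_zero, ← sub_mul, ← map_sub, ← map_mul]
    obtain ⟨_ | _, i⟩ := a
    · exact toModel_relator (.diagonal_x i e)
    · exact toModel_relator (.diagonal_y i e)
  have h1 := key ⟨s(u, v), h⟩
  rcases le_total u v with huv | huv
  · simpa [head, tail, huv] using h1.symm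
  · simpa [head, tail, huv] using h1

/-- The classes of the generators form a letter system in the model. -/
noncomputable def modelLetters (Γ : SimpleGraph V) (hg : 0 < g) :
    LetterSystem Γ g (Model Γ g) where
  h a v := toModel Γ g (gen (a.generator v))
  ω v := toModel Γ g (X ⟨0, hg⟩ v * Y ⟨0, hg⟩ v)
  γ := modelEdge g
  γ_symm := modelEdge_symm
  γ_of_not_adj _ _ := modelEdge_of_not_adj
  h_anticomm _ _ _ _ := toModel_anticomm _ _
  γ_mul_h u v a w := by
    by_cases h : Γ.Adj u v
    · rw [modelEdge_of_adj h]
      exact toModel_anticomm _ _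
    · simp [modelEdge_of_not_adj h]
  γ_anticomm := modelEdge_anticomm
  h_mul_h a b v := by
    have hsq : ∀ s : Generator Γ g, toModel Γ g (gen s) * toModel Γ g (gen s) = 0 := fun s =>
      LetterSystem.sq_eq_zero_of_anticomm (toModel_anticomm s s)
    have hxy : ∀ i j, toModel Γ g (gen (.x i v)) * toModel Γ g (gen (.y j v)) =
        if i = j then toModel Γ g (X ⟨0, hg⟩ v * Y ⟨0, hg⟩ v) else 0 := by
      intro i j
      split_ifs with hij
      · rw [← hij, ← map_mul, ← sub_eq_zero, ← map_sub]
        exact toModel_relator (.point_class i ⟨0, hg⟩ v)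
      · rw [← map_mul]
        exact toModel_relator (.x_mul_y i j hij v)
    obtain ⟨s, i⟩ := a
    obtain ⟨t, j⟩ := b
    by_cases hij : i = j
    · subst hij
      cases s <;> cases t <;> simp only [FormIndex.generator, pairing, FormIndex.conj]
      · simpa using hsq _
      · simpa using hxy i i
      · rw [toModel_anticomm]
        simpa using hxy i i
      · simpa using hsq _
    · cases s <;> cases t <;>
        simp only [FormIndex.generator, pairing, FormIndex.conj, Prod.mk.injEq, Ne.symm hij,
          and_false, if_false, zero_smul]
      · rw [← map_mul]
        exact toModel_relator (.x_mul_x i j hij v)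
      · simpa [hij] using hxy i j
      · rw [toModel_anticomm]
        simpa [Ne.symm hij] using hxy j i
      · rw [← map_mul]
        exact toModel_relator (.y_mul_y i j hij v)
  h_mul_γ := toModel_generator_mul_modelEdge
  triangle := modelEdge_triangle

theorem LetterSystem.lift_h {R : Type*} [Ring R] [Algebra ℚ R] (L : LetterSystem Γ g R)
    (hΓ : IsChordalGraph Γ) (hg : 0 < g) (a : FormIndex g) (v : V) :
    L.lift hΓ ((modelLetters Γ hg).h a v) = L.h a v := by
  refine (L.lift_mk hΓ _).trans ?_
  obtain ⟨_ | _, i⟩ := a <;> rfl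

theorem LetterSystem.lift_γ {R : Type*} [Ring R] [Algebra ℚ R] (L : LetterSystem Γ g R)
    (hΓ : IsChordalGraph Γ) (hg : 0 < g) (u v : V) :
    L.lift hΓ ((modelLetters Γ hg).γ u v) = L.γ u v := by
  change L.lift hΓ (modelEdge g u v) = _
  by_cases h : Γ.Adj u v
  · rw [modelEdge_of_adj h]
    exact L.lift_mk hΓ _
  · rw [modelEdge_of_not_adj h, L.γ_of_not_adj _ _ h, map_zero]

end Model

end CurveArrangement

namespace CurveArrangement

/-! ### The grading of the model -/

theorem generator_finite {V : Type u} [Finite V] {Γ : SimpleGraph V} {g : ℕ} :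
    Finite (Generator Γ g) := by
  let f : Generator Γ g → (Fin g × V) ⊕ (Fin g × V) ⊕ Γ.edgeSet
    | .x i v => .inl (i, v)
    | .y i v => .inr (.inl (i, v))
    | .edge e => .inr (.inr e)
  refine Finite.of_injective f ?_
  intro s t h
  cases s <;> cases t <;> simp_all [f]

theorem ι_mem_exteriorPower_one {V : Type u} {Γ : SimpleGraph V} {g : ℕ}
    (m : Generator Γ g →₀ ℚ) :
    ExteriorAlgebra.ι ℚ m ∈ ⋀[ℚ]^1 (Generator Γ g →₀ ℚ) := by
  rw [ExteriorAlgebra.exteriorPower, pow_one]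
  exact LinearMap.mem_range_self _ _

section Grading

variable {V : Type u} {Γ : SimpleGraph V} {g : ℕ}

theorem gen_mem (s : Generator Γ g) : gen s ∈ ⋀[ℚ]^1 (Generator Γ g →₀ ℚ) :=
  ι_mem_exteriorPower_one _

theorem prod_map_gen_mem {α : Type*} (f : α → Generator Γ g) (l : List α) :
    (l.map fun a => gen (f a)).prod ∈ ⋀[ℚ]^l.length (Generator Γ g →₀ ℚ) := by
  induction l with
  | nil => exact SetLike.GradedOne.one_mem
  | cons a l ih =>
    rw [List.map_cons, List.prod_cons, List.length_cons, add_comm]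
    exact SetLike.GradedMul.mul_mem (gen_mem _) ih

variable [LinearOrder V]

/-- Homogeneity of the relators is what lets the decomposition of the exterior algebra descend to
the model. -/
theorem IsRelator.exists_mem_exteriorPower {r : FreeModel Γ g} (hr : IsRelator r) :
    ∃ n, r ∈ ⋀[ℚ]^n (Generator Γ g →₀ ℚ) := by
  have hmul : ∀ s t : Generator Γ g, gen s * gen t ∈ ⋀[ℚ]^2 (Generator Γ g →₀ ℚ) := fun s t =>
    SetLike.GradedMul.mul_mem (i := 1) (j := 1) (gen_mem s) (gen_mem t)
  cases hr with
  | orlikSolomon l hl =>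
    refine ⟨l.length - 1, Submodule.sum_mem _ fun j hj => ?_⟩
    have h1 := prod_map_gen_mem (g := g) Generator.edge (l.eraseIdx j)
    rw [List.length_eraseIdx_of_lt (Finset.mem_range.1 hj)] at h1
    rcases neg_one_pow_eq_or (FreeModel Γ g) (j + 1) with h | h <;> rw [h]
    · rw [one_mul]; exact h1
    · rw [neg_one_mul]; exact neg_mem h1
  | diagonal_x i e => exact ⟨2, by rw [sub_mul]; exact sub_mem (hmul _ _) (hmul _ _)⟩
  | diagonal_y i e => exact ⟨2, by rw [sub_mul]; exact sub_mem (hmul _ _) (hmul _ _)⟩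
  | x_mul_y i j hij v => exact ⟨2, hmul _ _⟩
  | x_mul_x i j hij v => exact ⟨2, hmul _ _⟩
  | y_mul_y i j hij v => exact ⟨2, hmul _ _⟩
  | point_class i j v => exact ⟨2, sub_mem (hmul _ _) (hmul _ _)⟩

instance modelGrading_gradedMonoid : SetLike.GradedMonoid (modelGrading Γ g) where
  one_mem := ⟨1, SetLike.GradedOne.one_mem, map_one (toModel Γ g)⟩
  mul_mem := by
    rintro i j _ _ ⟨a, ha, rfl⟩ ⟨b, hb, rfl⟩
    exact ⟨a * b, SetLike.GradedMul.mul_mem ha hb, map_mul (toModel Γ g) a b⟩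

/-- The generators as homogeneous elements of the model. -/
noncomputable def gradedGenerators (Γ : SimpleGraph V) (g : ℕ) :
    (Generator Γ g →₀ ℚ) →ₗ[ℚ] DirectSum ℕ fun n => modelGrading Γ g n :=
  DirectSum.lof ℚ ℕ (fun n => modelGrading Γ g n) 1 ∘ₗ
    ((toModel Γ g).toLinearMap ∘ₗ ExteriorAlgebra.ι ℚ).codRestrict _ fun m =>
      ⟨ExteriorAlgebra.ι ℚ m, ι_mem_exteriorPower_one m, rfl⟩

theorem gradedGenerators_apply (m : Generator Γ g →₀ ℚ) :
    gradedGenerators Γ g m = DirectSum.of (fun n => modelGrading Γ g n) 1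
      ⟨toModel Γ g (ExteriorAlgebra.ι ℚ m), ⟨ExteriorAlgebra.ι ℚ m, ι_mem_exteriorPower_one m, rfl⟩⟩ := rfl

/-- The decomposition of the image in the model of an element of the exterior algebra. -/
noncomputable def freeDecompose (Γ : SimpleGraph V) (g : ℕ) :
    FreeModel Γ g →ₐ[ℚ] DirectSum ℕ fun n => modelGrading Γ g n :=
  ExteriorAlgebra.lift ℚ ⟨gradedGenerators Γ g, fun m => by
    rw [gradedGenerators_apply, DirectSum.of_mul_of]
    refine DFinsupp.single_eq_zero.mpr (Subtype.ext ?_)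
    refine (map_mul (toModel Γ g) _ _).symm.trans ?_
    rw [ExteriorAlgebra.ι_sq_zero, map_zero]
    rfl⟩

theorem freeDecompose_of_mem {n : ℕ} {x : FreeModel Γ g}
    (hx : x ∈ ⋀[ℚ]^n (Generator Γ g →₀ ℚ)) :
    freeDecompose Γ g x =
      DirectSum.of (fun n => modelGrading Γ g n) n ⟨toModel Γ g x, x, hx, rfl⟩ := by
  induction hx using Submodule.pow_induction_on_left' with
  | algebraMap r =>
    rw [AlgHom.commutes, DirectSum.algebraMap_apply]
    congr 1
    exact Subtype.ext (AlgHom.commutes (toModel Γ g) r).symm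
  | add x y i hx hy ihx ihy =>
    rw [map_add, ihx, ihy, ← map_add]
    congr 1
    exact Subtype.ext (map_add (toModel Γ g) x y).symm
  | mem_mul m hm i x hx ih =>
    obtain ⟨m, rfl⟩ := hm
    rw [map_mul, ih, freeDecompose, ExteriorAlgebra.lift_ι_apply, gradedGenerators_apply,
      DirectSum.of_mul_of]
    refine DirectSum.of_eq_of_gradedMonoid_eq (Sigma.subtype_ext (add_comm _ _) ?_)
    exact (map_mul (toModel Γ g) _ _).symm

/-- The decomposition of an element of the model. -/
noncomputable def modelDecompose (Γ : SimpleGraph V) (g : ℕ) :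
    Model Γ g →ₐ[ℚ] DirectSum ℕ fun n => modelGrading Γ g n :=
  RingQuot.liftAlgHom ℚ ⟨freeDecompose Γ g, fun a b h => by
    obtain ⟨n, hn⟩ := h.1.exists_mem_exteriorPower
    rw [h.2, map_zero, freeDecompose_of_mem hn]
    refine DFinsupp.single_eq_zero.mpr (Subtype.ext ?_)
    exact toModel_relator h.1⟩

theorem modelDecompose_toModel (x : FreeModel Γ g) :
    modelDecompose Γ g (toModel Γ g x) = freeDecompose Γ g x := by
  simp [modelDecompose]

noncomputable instance modelGradedAlgebra : GradedAlgebra (modelGrading Γ g) :=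
  GradedAlgebra.ofAlgHom _ (modelDecompose Γ g)
    (by
      refine RingQuot.ringQuot_ext' ℚ _ _ (ExteriorAlgebra.hom_ext (LinearMap.ext fun m => ?_))
      change DirectSum.coeAlgHom (modelGrading Γ g) (modelDecompose Γ g (toModel Γ g _)) =
        toModel Γ g _
      rw [modelDecompose_toModel, freeDecompose, ExteriorAlgebra.lift_ι_apply,
        gradedGenerators_apply, DirectSum.coeAlgHom_of])
    (by
      rintro n ⟨_, x, hx, rfl⟩
      exact (modelDecompose_toModel x).trans (freeDecompose_of_mem hx))

theorem modelGrading_zero : modelGrading Γ g 0 = 1 := by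
  rw [modelGrading, ExteriorAlgebra.exteriorPower, pow_zero, Submodule.map_one]

/-- Sending all letters to zero respects the relations and gives an algebra map onto `ℚ`. -/
theorem model_nontrivial (hΓ : IsChordalGraph Γ) : Nontrivial (Model Γ g) := by
  let L : LetterSystem Γ g ℚ :=
    { h := 0, ω := 0, γ := 0, γ_symm := by simp, γ_of_not_adj := by simp, h_anticomm := by simp
      γ_mul_h := by simp, γ_anticomm := by simp, h_mul_h := by simp, h_mul_γ := by simp
      triangle := by simp }
  exact (L.lift hΓ).toRingHom.domain_nontrivial

theorem isConnectedGrading_model (hΓ : IsChordalGraph Γ) :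
    IsConnectedGrading ℚ (modelGrading Γ g) where
  nontrivial := model_nontrivial hΓ
  gradedMonoid := inferInstance
  isInternal := DirectSum.Decomposition.isInternal _
  zero_eq := modelGrading_zero

theorem modelGrading_finiteDimensional [Finite V] (n : ℕ) :
    FiniteDimensional ℚ (modelGrading Γ g n) := by
  have := generator_finite (Γ := Γ) (g := g)
  have : Module.Finite ℚ (⋀[ℚ]^n (Generator Γ g →₀ ℚ)) := inferInstance
  exact Module.Finite.map _ _

theorem toModel_gen_mem (s : Generator Γ g) : toModel Γ g (gen s) ∈ modelGrading Γ g 1 :=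
  ⟨gen s, gen_mem s, rfl⟩

theorem modelLetters_h_mem (hg : 0 < g) (a : FormIndex g) (v : V) :
    (modelLetters Γ hg).h a v ∈ modelGrading Γ g 1 := toModel_gen_mem _

theorem modelLetters_γ_mem (hg : 0 < g) (u v : V) :
    (modelLetters Γ hg).γ u v ∈ modelGrading Γ g 1 := by
  change modelEdge g u v ∈ _
  by_cases h : Γ.Adj u v
  · rw [modelEdge_of_adj h]
    exact toModel_gen_mem _
  · rw [modelEdge_of_not_adj h]
    exact zero_mem _

/-- A property which holds for the letters holds for the generators. -/
theorem forall_toModel_gen (hg : 0 < g) {p : Model Γ g → Prop}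
    (hh : ∀ a v, p ((modelLetters Γ hg).h a v)) (hγ : ∀ u v, p ((modelLetters Γ hg).γ u v))
    (s : Generator Γ g) : p (toModel Γ g (gen s)) := by
  cases s with
  | x i v => exact hh (false, i) v
  | y i v => exact hh (true, i) v
  | edge e =>
    obtain ⟨e, he⟩ := e
    induction e with | _ u v
    have := hγ u v
    rwa [show (modelLetters Γ hg).γ u v = _ from modelEdge_of_adj he] at this

theorem toModel_ι_mem_span (m : Generator Γ g →₀ ℚ) :
    toModel Γ g (ExteriorAlgebra.ι ℚ m) ∈
      Submodule.span ℚ (Set.range fun s : Generator Γ g => toModel Γ g (gen s)) := by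
  induction m using Finsupp.induction_linear with
  | zero => rw [map_zero, map_zero]; exact zero_mem _
  | add p q hp hq => rw [map_add, map_add]; exact add_mem hp hq
  | single s r =>
    rw [← mul_one r, ← smul_eq_mul, ← Finsupp.smul_single, map_smul, map_smul]
    exact Submodule.smul_mem _ _ (Submodule.subset_span ⟨s, rfl⟩)

/-- A subspace which contains `1` and is stable under left multiplication by the letters is
everything. -/
theorem eq_top_of_letters_mul_mem (hg : 0 < g) {N : Submodule ℚ (Model Γ g)} (h1 : 1 ∈ N)
    (hh : ∀ a v, ∀ n ∈ N, (modelLetters Γ hg).h a v * n ∈ N)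
    (hγ : ∀ u v, ∀ n ∈ N, (modelLetters Γ hg).γ u v * n ∈ N) : N = ⊤ := by
  rw [Submodule.eq_top_iff']
  intro x
  obtain ⟨x, rfl⟩ := RingQuot.mkAlgHom_surjective ℚ
    (fun a b : FreeModel Γ g => IsRelator a ∧ b = 0) x
  induction x using CliffordAlgebra.left_induction with
  | algebraMap r =>
    rw [AlgHom.commutes, Algebra.algebraMap_eq_smul_one]
    exact N.smul_mem r h1
  | add x y hx hy => rw [map_add]; exact add_mem hx hy
  | ι_mul x m hx =>
    rw [map_mul]
    have h2 := toModel_ι_mem_span m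
    change toModel Γ g (ExteriorAlgebra.ι ℚ m) * toModel Γ g x ∈ N
    generalize toModel Γ g (ExteriorAlgebra.ι ℚ m) = z at h2
    induction h2 using Submodule.span_induction with
    | mem z hz =>
      obtain ⟨s, rfl⟩ := hz
      exact forall_toModel_gen hg (p := fun z => z * toModel Γ g x ∈ N)
        (fun a v => hh a v _ hx) (fun u v => hγ u v _ hx) s
    | zero => rw [zero_mul]; exact zero_mem _
    | add z z' _ _ h h' => rw [add_mul]; exact add_mem h h'
    | smul r z _ h => rw [smul_mul_assoc]; exact N.smul_mem r h

theorem augmentationIdeal_model (hg : 0 < g) :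
    augmentationIdeal (modelGrading Γ g) = Ideal.span
      ({z | ∃ a v, z = (modelLetters Γ hg).h a v} ∪ {z | ∃ u v, z = (modelLetters Γ hg).γ u v}) := by
  set J := Ideal.span
    ({z | ∃ a v, z = (modelLetters Γ hg).h a v} ∪ {z | ∃ u v, z = (modelLetters Γ hg).γ u v})
  apply le_antisymm
  · have hgen : ∀ s : Generator Γ g, toModel Γ g (gen s) ∈ J :=
      forall_toModel_gen hg (p := fun z => z ∈ J)
        (fun a v => Ideal.subset_span (Or.inl ⟨a, v, rfl⟩))
        (fun u v => Ideal.subset_span (Or.inr ⟨u, v, rfl⟩))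
    have hι : ∀ m, toModel Γ g (ExteriorAlgebra.ι ℚ m) ∈ J := fun m =>
      Submodule.span_le.2 (by rintro _ ⟨s, rfl⟩; exact hgen s :
        _ ≤ ((J.restrictScalars ℚ : Submodule ℚ (Model Γ g)) : Set (Model Γ g)))
        (toModel_ι_mem_span m)
    refine Ideal.span_le.2 ?_
    rintro _ ⟨n, hn, x, hx, rfl⟩
    obtain ⟨n, rfl⟩ : ∃ n', n = n' + 1 := ⟨n - 1, by omega⟩
    rw [SetLike.mem_coe, ExteriorAlgebra.exteriorPower, pow_succ] at hx
    change toModel Γ g x ∈ J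
    induction hx using Submodule.mul_induction_on' with
    | mem_mul_mem y _ z hz =>
      obtain ⟨m, rfl⟩ := hz
      rw [map_mul]
      exact J.mul_mem_left _ (hι m)
    | add y _ z _ hy hz => rw [map_add]; exact add_mem hy hz
  · refine Ideal.span_le.2 ?_
    rintro z (⟨a, v, rfl⟩ | ⟨u, v, rfl⟩)
    · exact Ideal.subset_span ⟨1, le_rfl, modelLetters_h_mem hg a v⟩
    · exact Ideal.subset_span ⟨1, le_rfl, modelLetters_γ_mem hg u v⟩

end Grading

end CurveArrangement

namespace CurveArrangement

/-! ### Adding a vertex to a letter system -/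

namespace LetterSystem

section Relations

variable {V : Type u} {Γ : SimpleGraph V} {g : ℕ} {R : Type*} [Ring R] [Algebra ℚ R]
  (L : LetterSystem Γ g R)

/-- Any dual pair computes the point class, so a left ideal containing a single `h a u` already
contains `ω u`. -/
theorem ω_eq (a : FormIndex g) (u : V) :
    L.ω u = (pairing a a.conj)⁻¹ • (L.h a u * L.h a.conj u) := by
  rw [L.h_mul_h, smul_smul, inv_mul_cancel₀ (pairing_conj_ne_zero a), one_smul]

theorem mul_ω_comm (hg : 0 < g) {z : R} {u : V} (hz : ∀ a, z * L.h a u = -(L.h a u * z)) :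
    z * L.ω u = L.ω u * z := by
  rw [L.ω_eq (false, ⟨0, hg⟩), mul_smul_comm, smul_mul_assoc, ← mul_assoc, hz, neg_mul, mul_assoc,
    hz, mul_neg, neg_neg, mul_assoc]

theorem h_mul_ω (a : FormIndex g) (u : V) : L.h a u * L.ω u = 0 := by
  rw [L.ω_eq a, mul_smul_comm, ← mul_assoc, L.h_sq, zero_mul, smul_zero]

/-- On `γ u v` the two factors of the point class move from `u` to `v` one at a time. -/
theorem ω_mul_γ (hg : 0 < g) (u v : V) : L.ω u * L.γ u v = L.ω v * L.γ u v := by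
  have key : ∀ a : FormIndex g, L.h a u * L.h a.conj u * L.γ u v =
      L.h a v * L.h a.conj v * L.γ u v := by
    intro a
    calc L.h a u * L.h a.conj u * L.γ u v = L.h a u * L.h a.conj v * L.γ u v := by
          rw [mul_assoc, L.h_mul_γ, mul_assoc]
      _ = -(L.h a.conj v * (L.h a u * L.γ u v)) := by
          rw [L.h_anticomm a u, neg_mul, mul_assoc]
      _ = -(L.h a.conj v * L.h a v) * L.γ u v := by rw [L.h_mul_γ a u v]; noncomm_ring
      _ = _ := by rw [← L.h_anticomm]
  rw [L.ω_eq (false, ⟨0, hg⟩), L.ω_eq (false, ⟨0, hg⟩) v, smul_mul_assoc, smul_mul_assoc, key]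

/-- The triangle relation, for three vertices which are pairwise equal or adjacent. -/
theorem γ_mul_γ {u v w : V} (huv : u ≠ v → Γ.Adj u v) (hvw : v ≠ w → Γ.Adj v w)
    (hwu : w ≠ u → Γ.Adj w u) :
    L.γ u v * L.γ u w = L.γ v w * L.γ u w - L.γ v w * L.γ u v := by
  by_cases h1 : u = v
  · subst h1
    rw [L.γ_self, zero_mul, mul_zero, L.γ_sq, sub_zero]
  by_cases h2 : v = w
  · subst h2
    rw [L.γ_self, L.γ_sq, zero_mul, sub_zero]
  by_cases h3 : w = u
  · subst h3
    rw [L.γ_self, mul_zero, mul_zero, L.γ_symm w v, L.γ_sq, sub_zero]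
  have h := L.triangle u v w (huv h1) (hvw h2) (hwu h3)
  rw [L.γ_symm w u] at h
  rw [L.γ_anticomm u v v w, L.γ_anticomm u w u v] at h
  rw [← sub_eq_zero, ← neg_eq_zero, ← h]
  abel

end Relations

end LetterSystem

/-- The index set of the basis `1`, `h a v`, `ω v`, `γ w v` of the model over the submodel without
the vertex `v`, whose neighbours are the elements of `N`. -/
inductive FiberIndex {V : Type u} (g : ℕ) (N : Finset V) : Type u
  | one
  | form (a : FormIndex g)
  | point
  | edge (w : N)

namespace LetterSystem

variable {V : Type u} {Γ : SimpleGraph V} {g : ℕ} {P : Type v} [AddCommGroup P]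
  [Module ℚ P] (N : Finset V)

variable {N} in
/-- A coordinate of the extension. -/
abbrev coordinate (b : FiberIndex g N) : (FiberIndex g N → P) →ₗ[ℚ] P := LinearMap.proj b

/-- The action of an even element of the submodel. -/
def extendEven (z : Module.End ℚ P) : Module.End ℚ (FiberIndex g N → P) :=
  LinearMap.pi fun b => z ∘ₗ LinearMap.proj b

/-- The action of an odd element of the submodel. -/
def extendOdd (z : Module.End ℚ P) : Module.End ℚ (FiberIndex g N → P) :=
  -- A function `f` stands for the sum of the basis elements times the `f b`; the signs come from
  -- moving an odd `z` past a basis element of odd degree.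
  LinearMap.pi fun
    | .one => z ∘ₗ LinearMap.proj .one
    | .form a => -(z ∘ₗ LinearMap.proj (.form a))
    | .point => z ∘ₗ LinearMap.proj .point
    | .edge w => -(z ∘ₗ LinearMap.proj (.edge w))

variable (L : LetterSystem Γ g (Module.End ℚ P))

/-- The action of the class `h a v` of the new vertex. -/
def newForm (a : FormIndex g) : Module.End ℚ (FiberIndex g N → P) :=
  LinearMap.pi fun
    | .one => 0
    | .form b => if b = a then LinearMap.proj .one else 0
    | .point => pairing a a.conj • LinearMap.proj (.form a.conj)
    -- On `γ v w` the class `h a v` equals `h a w`, which must then pass the odd element `γ v w`.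
    | .edge w => -(L.h a w ∘ₗ LinearMap.proj (.edge w))

/-- The action of the class `ω v` of the new vertex. -/
def newPoint : Module.End ℚ (FiberIndex g N → P) :=
  LinearMap.pi fun
    | .one => 0
    | .form _ => 0
    | .point => LinearMap.proj .one
    | .edge w => L.ω w ∘ₗ LinearMap.proj (.edge w)

/-- The restriction to the diagonal `z_v = z_w`. -/
def restrictDiagonal (w : V) : (FiberIndex g N → P) →ₗ[ℚ] P :=
  coordinate .one + ∑ b, L.h b w ∘ₗ coordinate (.form b) +
    L.ω w ∘ₗ coordinate .point + ∑ u : N, L.γ u w ∘ₗ coordinate (.edge u)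

/-- The action of the class of an edge of the new vertex. -/
def newEdge [DecidableEq V] (w : V) : Module.End ℚ (FiberIndex g N → P) :=
  LinearMap.pi fun
    | .one => 0
    | .form _ => 0
    | .point => 0
    -- The triangle relation in the form `γ v w * γ v u = γ v w * γ u w - γ v u * γ u w`: the first
    -- term is part of the restriction to the diagonal, which sits at `γ v w`; the second is the
    -- correction at `γ v u`.
    | .edge u => (if (u : V) = w then restrictDiagonal N L w else 0) -
        L.γ u w ∘ₗ LinearMap.proj (.edge u)

theorem restrictDiagonal_apply (w : V) (f : FiberIndex g N → P) :
    restrictDiagonal N L w f = f .one + ∑ b, L.h b w (f (.form b)) + L.ω w (f .point) +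
      ∑ u : N, L.γ u w (f (.edge u)) := by
  simp [restrictDiagonal]

section Apply

variable (z : Module.End ℚ P) (a b : FormIndex g) (w : V) (x : N) (f : FiberIndex g N → P)

@[simp] theorem extendEven_apply (b : FiberIndex g N) : extendEven N z f b = z (f b) := rfl

@[simp] theorem extendOdd_one : extendOdd N z f .one = z (f .one) := rfl

@[simp] theorem extendOdd_form : extendOdd N z f (.form b) = -z (f (.form b)) := rfl

@[simp] theorem extendOdd_point : extendOdd N z f .point = z (f .point) := rfl

@[simp] theorem extendOdd_edge : extendOdd N z f (.edge x) = -z (f (.edge x)) := rfl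

@[simp] theorem newForm_one : newForm N L a f .one = 0 := rfl

@[simp] theorem newForm_form :
    newForm N L a f (.form b) = if b = a then f .one else 0 := by
  simp only [newForm, LinearMap.pi_apply]
  split_ifs <;> rfl

@[simp] theorem newForm_point :
    newForm N L a f .point = pairing a a.conj • f (.form a.conj) := rfl

@[simp] theorem newForm_edge : newForm N L a f (.edge x) = -L.h a x (f (.edge x)) := rfl

@[simp] theorem newPoint_one : newPoint N L f .one = 0 := rfl

@[simp] theorem newPoint_form : newPoint N L f (.form b) = 0 := rfl

@[simp] theorem newPoint_point : newPoint N L f .point = f .one := rfl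

@[simp] theorem newPoint_edge : newPoint N L f (.edge x) = L.ω x (f (.edge x)) := rfl

@[simp] theorem newEdge_one [DecidableEq V] : newEdge N L w f .one = 0 := rfl

@[simp] theorem newEdge_form [DecidableEq V] : newEdge N L w f (.form b) = 0 := rfl

@[simp] theorem newEdge_point [DecidableEq V] : newEdge N L w f .point = 0 := rfl

@[simp] theorem newEdge_edge [DecidableEq V] : newEdge N L w f (.edge x) =
    (if (x : V) = w then restrictDiagonal N L w f else 0) - L.γ x w (f (.edge x)) := by
  simp only [newEdge, LinearMap.pi_apply]
  split_ifs <;> rfl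

end Apply

theorem apply_apply_of_anticomm {z z' : Module.End ℚ P} (h : z * z' = -(z' * z)) (p : P) :
    z (z' p) = -z' (z p) := LinearMap.congr_fun h p

theorem extendOdd_anticomm {z z' : Module.End ℚ P} (h : z * z' = -(z' * z)) :
    extendOdd (g := g) N z * extendOdd N z' = -(extendOdd N z' * extendOdd N z) := by
  ext f b
  cases b <;> simp [apply_apply_of_anticomm h]

theorem extendOdd_newForm {z : Module.End ℚ P} (a : FormIndex g)
    (hz : ∀ u, z * L.h a u = -(L.h a u * z)) :
    extendOdd N z * newForm N L a = -(newForm N L a * extendOdd N z) := by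
  ext f b
  cases b with
  | form b => by_cases h : b = a <;> simp [h]
  | _ => simp [apply_apply_of_anticomm (hz _)]

theorem extendOdd_newEdge [DecidableEq V] (hg : 0 < g) {z : Module.End ℚ P}
    (hh : ∀ a u, z * L.h a u = -(L.h a u * z)) (hγ : ∀ u v, z * L.γ u v = -(L.γ u v * z))
    (w : V) : extendOdd N z * newEdge N L w = -(newEdge N L w * extendOdd N z) := by
  have hω : ∀ u p, z (L.ω u p) = L.ω u (z p) := fun u p =>
    LinearMap.congr_fun (L.mul_ω_comm hg fun a => hh a u) p
  ext f b
  cases b with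
  | edge u =>
    by_cases hu : (u : V) = w
    · simp [restrictDiagonal_apply, apply_apply_of_anticomm (hh _ _),
        apply_apply_of_anticomm (hγ _ _), hω, hu]
    · simp [apply_apply_of_anticomm (hγ _ _), hu]
  | _ => simp

theorem newForm_mul_newForm (a b : FormIndex g) :
    newForm N L a * newForm N L b = pairing a b • newPoint N L := by
  ext f c
  cases c with
  | edge u =>
    have := LinearMap.congr_fun (L.h_mul_h a b u) (f (.edge u))
    simpa using this
  | point =>
    by_cases h : b = a.conj
    · subst h; simp
    · simp [pairing_of_ne h, Ne.symm h]
  | _ => simp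

theorem newForm_anticomm (a b : FormIndex g) :
    newForm N L a * newForm N L b = -(newForm N L b * newForm N L a) := by
  rw [newForm_mul_newForm, newForm_mul_newForm, pairing_swap]
  exact neg_smul (pairing b a) (newPoint N L)

theorem h_γ_apply (a : FormIndex g) (u v : V) (p : P) :
    L.h a u (L.γ u v p) = L.h a v (L.γ u v p) := LinearMap.congr_fun (L.h_mul_γ a u v) p

theorem newForm_mul_newEdge [DecidableEq V] (a : FormIndex g) {w : V} :
    newForm N L a * newEdge N L w = extendOdd N (L.h a w) * newEdge N L w := by
  ext f c
  cases c with
  | edge u =>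
    by_cases hu : (u : V) = w
    · simp [hu]
    · simp [hu, h_γ_apply]
  | _ => simp

/-- Restriction to `z_v = z_w` turns `h a v` into `h a w`; this is why the operators of the edge and
of the form at `v` anticommute. -/
theorem restrictDiagonal_newForm (w : V) (a : FormIndex g) (f : FiberIndex g N → P) :
    restrictDiagonal N L w (newForm N L a f) = L.h a w (restrictDiagonal N L w f) := by
  have h1 : ∀ b p, L.h a w (L.h b w p) = pairing a b • L.ω w p := fun b p =>
    LinearMap.congr_fun (L.h_mul_h a b w) p
  have h2 : ∀ p, L.h a w (L.ω w p) = 0 := fun p => LinearMap.congr_fun (L.h_mul_ω a w) p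
  have h3 : ∀ (u : V) p, L.γ u w (L.h a u p) = -L.h a w (L.γ u w p) := fun u p => by
    rw [apply_apply_of_anticomm (L.γ_mul_h u w a u), h_γ_apply]
  simp only [restrictDiagonal_apply, newForm_one, newForm_form, newForm_point, newForm_edge,
    map_add, map_sum, map_neg, map_smul, h1, h2, h3, neg_neg, zero_add, add_zero]
  congr 2
  · rw [Finset.sum_eq_single a (fun b _ hb => by simp [hb]) (by simp)]
    simp
  · rw [Finset.sum_eq_single a.conj (fun b _ hb => by simp [pairing_of_ne hb]) (by simp)]

theorem newEdge_newForm [DecidableEq V] (w : V) (a : FormIndex g) :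
    newEdge N L w * newForm N L a = -(newForm N L a * newEdge N L w) := by
  ext f c
  cases c with
  | edge u =>
    by_cases hu : (u : V) = w
    · simp [hu, restrictDiagonal_newForm, L.γ_self]
    · simp [hu, apply_apply_of_anticomm (L.γ_mul_h _ _ _ _)]
  | _ => simp

/-- After multiplication by `γ w w'` the restrictions to `z_v = z_w` and `z_v = z_w'` agree on all
coordinates except those of edges, and there the triangle relations of the clique `N` give the
difference. -/
theorem γ_restrictDiagonal (hg : 0 < g) {w w' : V} (hw : w ∈ N) (hw' : w' ∈ N)
    (hN : ∀ u ∈ N, ∀ v ∈ N, u ≠ v → Γ.Adj u v) (f : FiberIndex g N → P) :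
    ∑ u : N, L.γ u w (L.γ u w' (f (.edge u))) =
      L.γ w w' (restrictDiagonal N L w' f) - L.γ w w' (restrictDiagonal N L w f) := by
  have h1 : ∀ b p, L.γ w w' (L.h b w' p) = L.γ w w' (L.h b w p) := fun b p => by
    rw [apply_apply_of_anticomm (L.γ_mul_h _ _ _ _), apply_apply_of_anticomm (L.γ_mul_h _ _ _ _),
      h_γ_apply]
  have h2 : ∀ p, L.γ w w' (L.ω w' p) = L.γ w w' (L.ω w p) := fun p => by
    have h := L.ω_mul_γ hg w w'
    rw [← L.mul_ω_comm hg fun a => L.γ_mul_h _ _ _ _,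
      ← L.mul_ω_comm hg fun a => L.γ_mul_h _ _ _ _] at h
    exact (LinearMap.congr_fun h p).symm
  have h3 : ∀ (u : N) p, L.γ u w (L.γ u w' p) =
      L.γ w w' (L.γ u w' p) - L.γ w w' (L.γ u w p) := fun u p =>
    LinearMap.congr_fun (L.γ_mul_γ (hN u u.2 w hw) (hN w hw w' hw') (hN w' hw' u u.2)) p
  simp only [restrictDiagonal_apply, map_add, map_sum, h1, h2, h3, Finset.sum_sub_distrib]
  abel

/-- Restriction to `z_v = z_w` turns `γ v w'` into `γ w w'`. -/
theorem restrictDiagonal_newEdge [DecidableEq V] (hg : 0 < g) {w w' : V} (hw : w ∈ N)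
    (hw' : w' ∈ N) (hN : ∀ u ∈ N, ∀ v ∈ N, u ≠ v → Γ.Adj u v) (f : FiberIndex g N → P) :
    restrictDiagonal N L w (newEdge N L w' f) = L.γ w w' (restrictDiagonal N L w f) := by
  have h1 : ∑ u : N, L.γ u w (if (u : V) = w' then restrictDiagonal N L w' f else 0) =
      L.γ w w' (restrictDiagonal N L w' f) := by
    rw [Finset.sum_eq_single ⟨w', hw'⟩ (fun u _ hu => ?_) (by simp), if_pos rfl, L.γ_symm]
    rw [if_neg fun h => hu (Subtype.ext h), map_zero]
  rw [restrictDiagonal_apply]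
  simp only [newEdge_one, newEdge_form, newEdge_point, newEdge_edge, map_zero,
    Finset.sum_const_zero, zero_add, map_sub, Finset.sum_sub_distrib]
  rw [h1, γ_restrictDiagonal N L hg hw hw' hN, sub_sub_cancel]

/-- This is the triangle relation at the new vertex. Both the anticommutativity of the new edges and
the `triangle` field of the extension are read off from it. -/
theorem newEdge_mul_newEdge [DecidableEq V] (hg : 0 < g) {w w' : V} (hw : w ∈ N) (hw' : w' ∈ N)
    (hN : ∀ u ∈ N, ∀ v ∈ N, u ≠ v → Γ.Adj u v) :
    newEdge N L w * newEdge N L w' =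
      extendOdd N (L.γ w w') * (newEdge N L w' - newEdge N L w) := by
  ext f c
  cases c with
  | edge u =>
    have h3 : ∀ p, L.γ u w (L.γ u w' p) = L.γ w w' (L.γ u w' p) - L.γ w w' (L.γ u w p) :=
      fun p => LinearMap.congr_fun (L.γ_mul_γ (hN u u.2 w hw) (hN w hw w' hw') (hN w' hw' u u.2)) p
    have h4 : L.γ u w (if (u : V) = w' then restrictDiagonal N L w' f else 0) =
        L.γ w w' (if (u : V) = w' then restrictDiagonal N L w' f else 0) := by
      split_ifs with h
      · rw [h, L.γ_symm]
      · rw [map_zero, map_zero]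
    have h5 : (if (u : V) = w then L.γ w w' (restrictDiagonal N L w f) else 0) =
        L.γ w w' (if (u : V) = w then restrictDiagonal N L w f else 0) := by
      split_ifs
      · rfl
      · rw [map_zero]
    simp only [Module.End.mul_apply, newEdge_edge, extendOdd_edge, LinearMap.sub_apply,
      Pi.sub_apply, restrictDiagonal_newEdge N L hg hw hw' hN, map_sub, h3, h4, h5]
    abel
  | _ => simp

end LetterSystem

end CurveArrangement

namespace CurveArrangement

namespace LetterSystem

theorem extendOdd_mul_extendOdd {V : Type u} {g : ℕ} {P : Type v}
    [AddCommGroup P] [Module ℚ P] (N : Finset V) (z z' : Module.End ℚ P) :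
    extendOdd (g := g) N z * extendOdd N z' = extendEven N (z * z') := by
  ext f b
  cases b <;> simp

theorem extendOdd_zero {V : Type u} {g : ℕ} {P : Type v} [AddCommGroup P] [Module ℚ P]
    (N : Finset V) : extendOdd (g := g) N (0 : Module.End ℚ P) = 0 := by
  ext f b
  cases b <;> simp

/-! ### The extended operators satisfy all the relations. -/

section Extend

variable {V : Type u} [DecidableEq V] {Γ : SimpleGraph V} {g : ℕ} {P : Type v} [AddCommGroup P]
  [Module ℚ P] (N : Finset V) (L : LetterSystem Γ g (Module.End ℚ P)) (v : V)

/-- The action of the class of an edge on the extension by the vertex `v`. -/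
noncomputable def extendγ (u w : V) : Module.End ℚ (FiberIndex g N → P) :=
  if u = v then (if w ∈ N then newEdge N L w else 0)
  else if w = v then (if u ∈ N then newEdge N L u else 0)
  else extendOdd N (L.γ u w)

/-- The action of the classes of degree one on the extension by the vertex `v`. -/
noncomputable def extendForm (a : FormIndex g) (u : V) : Module.End ℚ (FiberIndex g N → P) :=
  if u = v then newForm N L a else extendOdd N (L.h a u)

theorem extendγ_cases (u w : V) :
    (∃ x y, extendγ N L v u w = extendOdd N (L.γ x y)) ∨
      ∃ x, extendγ N L v u w = newEdge N L x := by
  have h0 : ∃ x y, (0 : Module.End ℚ (FiberIndex g N → P)) = extendOdd N (L.γ x y) :=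
    ⟨v, v, by rw [L.γ_self, extendOdd_zero]⟩
  unfold extendγ
  split_ifs
  exacts [Or.inr ⟨_, rfl⟩, Or.inl h0, Or.inr ⟨_, rfl⟩, Or.inl h0, Or.inl ⟨_, _, rfl⟩]

theorem extendForm_cases (a : FormIndex g) (u : V) :
    (extendForm N L v a u = extendOdd N (L.h a u)) ∨ extendForm N L v a u = newForm N L a := by
  unfold extendForm
  split_ifs
  exacts [Or.inr rfl, Or.inl rfl]

variable {N v}

theorem extendγ_symm (u w : V) : extendγ N L v u w = extendγ N L v w u := by
  unfold extendγ
  by_cases hu : u = v <;> by_cases hw : w = v <;> simp [hu, hw, L.γ_symm]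

theorem newEdge_anticomm (hg : 0 < g) (hN : ∀ u ∈ N, ∀ v ∈ N, u ≠ v → Γ.Adj u v) {w w' : V}
    (hw : w ∈ N) (hw' : w' ∈ N) :
    newEdge N L w * newEdge N L w' = -(newEdge N L w' * newEdge N L w) := by
  rw [newEdge_mul_newEdge N L hg hw hw' hN, newEdge_mul_newEdge N L hg hw' hw hN, L.γ_symm w' w,
    mul_sub, mul_sub]
  abel

/-- The case of interest is `u, w ∈ N`. If a neighbour of `v` lies outside `N`, its edge to `v` acts
by zero, and `hγ` makes the remaining product vanish as well. -/
theorem extendγ_triangle (hg : 0 < g) (hN : ∀ u ∈ N, ∀ v ∈ N, u ≠ v → Γ.Adj u v)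
    (hγ : ∀ w, Γ.Adj v w → w ∉ N → ∀ u, L.γ u w = 0) {u w : V} (hu : Γ.Adj v u)
    (hw : Γ.Adj v w) :
    extendγ N L v v u * extendγ N L v u w + extendγ N L v u w * extendγ N L v w v +
      extendγ N L v w v * extendγ N L v v u = 0 := by
  rw [extendγ_symm L w v]
  simp only [extendγ, if_true, if_neg hu.ne', if_neg hw.ne']
  by_cases hu' : u ∈ N
  · by_cases hw' : w ∈ N
    · rw [if_pos hu', if_pos hw', newEdge_mul_newEdge N L hg hw' hu' hN, L.γ_symm w u]
      have h := extendOdd_newEdge N L hg (z := L.γ u w) (fun a x => L.γ_mul_h u w a x)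
        (fun x y => L.γ_anticomm u w x y) u
      rw [mul_sub, h]
      abel
    · rw [hγ w hw hw' u, extendOdd_zero, if_neg hw']
      simp
  · rw [L.γ_symm, hγ u hu hu' w, extendOdd_zero, if_neg hu']
    simp

/-- The extension of a letter system by the vertex `v`, whose neighbours are the elements of
`N`. -/
noncomputable def extend (hg : 0 < g) (hN : ∀ u ∈ N, ∀ v ∈ N, u ≠ v → Γ.Adj u v)
    (hadj : ∀ u ∈ N, Γ.Adj v u) (hγ : ∀ w, Γ.Adj v w → w ∉ N → ∀ u, L.γ u w = 0) :
    LetterSystem Γ g (Module.End ℚ (FiberIndex g N → P)) where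
  h := extendForm N L v
  ω u := if u = v then newPoint N L else extendEven N (L.ω u)
  γ := extendγ N L v
  γ_symm := extendγ_symm L
  γ_of_not_adj u w h := by
    unfold extendγ
    split_ifs with h1 h2 h3 h4
    · exact absurd (h1 ▸ hadj w h2) h
    · rfl
    · exact absurd (h3 ▸ (hadj u h4).symm) h
    · rfl
    · rw [L.γ_of_not_adj u w h, extendOdd_zero]
  h_anticomm a u b w := by
    rcases extendForm_cases N L v a u with h | h <;>
      rcases extendForm_cases N L v b w with h' | h' <;> rw [h, h']
    · exact extendOdd_anticomm N (L.h_anticomm a u b w)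
    · exact extendOdd_newForm N L b fun x => L.h_anticomm a u b x
    · rw [extendOdd_newForm N L a fun x => L.h_anticomm b w a x, neg_neg]
    · exact newForm_anticomm N L a b
  γ_mul_h u w a x := by
    rcases extendγ_cases N L v u w with ⟨y, y', h⟩ | ⟨y, h⟩ <;>
      rcases extendForm_cases N L v a x with h' | h' <;> rw [h, h']
    · exact extendOdd_anticomm N (L.γ_mul_h y y' a x)
    · exact extendOdd_newForm N L a fun x => L.γ_mul_h y y' a x
    · rw [extendOdd_newEdge N L hg (fun b z => L.h_anticomm a x b z)
        (fun z z' => L.h_mul_γ_anticomm a x z z'), neg_neg]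
    · exact newEdge_newForm N L y a
  γ_anticomm u w u' w' := by
    -- Membership in `N` is recorded here, because two new edges anticommute only through the clique
    -- relations.
    have hcases : ∀ u w, (∃ x y, extendγ N L v u w = extendOdd N (L.γ x y)) ∨
        ∃ x ∈ N, extendγ N L v u w = newEdge N L x := by
      intro u w
      have h0 : ∃ x y, (0 : Module.End ℚ (FiberIndex g N → P)) = extendOdd N (L.γ x y) :=
        ⟨v, v, by rw [L.γ_self, extendOdd_zero]⟩
      unfold extendγ
      split_ifs with h1 h2 h3 h4
      exacts [Or.inr ⟨_, h2, rfl⟩, Or.inl h0, Or.inr ⟨_, h4, rfl⟩, Or.inl h0, Or.inl ⟨_, _, rfl⟩]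
    rcases hcases u w with ⟨x, y, h⟩ | ⟨x, hx, h⟩ <;>
      rcases hcases u' w' with ⟨x', y', h'⟩ | ⟨x', hx', h'⟩ <;> rw [h, h']
    · exact extendOdd_anticomm N (L.γ_anticomm x y x' y')
    · exact extendOdd_newEdge N L hg (fun a z => L.γ_mul_h x y a z)
        (fun z z' => L.γ_anticomm x y z z') x'
    · rw [extendOdd_newEdge N L hg (fun a z => L.γ_mul_h x' y' a z)
        (fun z z' => L.γ_anticomm x' y' z z'), neg_neg]
    · exact newEdge_anticomm L hg hN hx hx'
  h_mul_h a b u := by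
    unfold extendForm
    split_ifs with h
    · exact newForm_mul_newForm N L a b
    · rw [extendOdd_mul_extendOdd, L.h_mul_h]
      ext f c
      simp
  h_mul_γ a u w := by
    have key : ∀ w, w ≠ v → extendForm N L v a v * extendγ N L v v w =
        extendForm N L v a w * extendγ N L v v w := by
      intro w hw
      simp only [extendForm, extendγ, if_true, if_neg hw]
      split_ifs with h
      · exact newForm_mul_newEdge N L a
      · simp
    by_cases hu : u = v <;> by_cases hw : w = v
    · rw [hu, hw]
    · rw [hu, key w hw]
    · rw [hw, extendγ_symm L, key u hu]
    · simp only [extendForm, extendγ, if_neg hu, if_neg hw]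
      rw [extendOdd_mul_extendOdd, extendOdd_mul_extendOdd, L.h_mul_γ]
  triangle u w x huw hwx hxu := by
    -- The triangle relation is cyclically symmetric, so the new vertex may be taken as the first
    -- one; without it, the old relation applies coordinatewise.
    by_cases hu : u = v
    · subst hu
      exact extendγ_triangle L hg hN hγ huw hxu.symm
    by_cases hw : w = v
    · subst hw
      rw [← extendγ_triangle L hg hN hγ hwx huw.symm]
      abel
    by_cases hx : x = v
    · subst hx
      rw [← extendγ_triangle L hg hN hγ hxu hwx.symm]
      abel
    · simp only [extendγ, if_neg hu, if_neg hw, if_neg hx, extendOdd_mul_extendOdd]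
      have h := L.triangle u w x huw hwx hxu
      ext f b
      exact LinearMap.congr_fun h (f b)

end Extend

/-! ### Spanning: the products of the fibre basis with a stable subspace. -/

section FiberBasis

variable {V : Type u} {Γ : SimpleGraph V} {g : ℕ} {R : Type*} [Ring R] [Algebra ℚ R]
  (L : LetterSystem Γ g R) (v : V) (N : Finset V)

/-- The basis elements `1`, `h a v`, `ω v`, `γ v w`. -/
def fiberBasis : FiberIndex g N → R
  | .one => 1
  | .form a => L.h a v
  | .point => L.ω v
  | .edge w => L.γ v w

instance : Finite (FiberIndex g N) := by
  let f : FiberIndex g N → Option (Option (FormIndex g ⊕ N))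
    | .one => none
    | .point => some none
    | .form a => some (some (.inl a))
    | .edge w => some (some (.inr w))
  refine Finite.of_injective f fun b c h => ?_
  cases b <;> cases c <;> simp_all [f]

/-- The subspace `M` is stable under left multiplication by the letters of the vertices of `T`. -/
structure IsStable (T : Finset V) (M : Submodule ℚ R) : Prop where
  h_mul_mem : ∀ a, ∀ u ∈ T, ∀ n ∈ M, L.h a u * n ∈ M
  γ_mul_mem : ∀ u ∈ T, ∀ w ∈ T, ∀ n ∈ M, L.γ u w * n ∈ M

/-- The subspace spanned by the products of the basis elements of the vertex `v` with the elements
of `M`. -/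
def fiberSpan (M : Submodule ℚ R) : Submodule ℚ R :=
  ⨆ b : FiberIndex g N, M.map (LinearMap.mulLeft ℚ (L.fiberBasis v N b))

variable {L N}

theorem mul_mem_fiberSpan {M : Submodule ℚ R} (b : FiberIndex g N) {n : R} (hn : n ∈ M) :
    L.fiberBasis v N b * n ∈ L.fiberSpan v N M :=
  Submodule.mem_iSup_of_mem b ⟨n, hn, rfl⟩

theorem le_fiberSpan (M : Submodule ℚ R) : M ≤ L.fiberSpan v N M := by
  intro n hn
  simpa [fiberBasis] using mul_mem_fiberSpan (L := L) v (N := N) .one hn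

theorem exists_sum_of_mem_fiberSpan [Fintype (FiberIndex g N)] {M : Submodule ℚ R} {x : R}
    (hx : x ∈ L.fiberSpan v N M) :
    ∃ n : FiberIndex g N → R, (∀ b, n b ∈ M) ∧ ∑ b, L.fiberBasis v N b * n b = x := by
  classical
  refine Submodule.iSup_induction _ (motive := fun x => ∃ n : FiberIndex g N → R,
    (∀ b, n b ∈ M) ∧ ∑ b, L.fiberBasis v N b * n b = x) hx ?_ ?_ ?_
  · rintro b _ ⟨n, hn, rfl⟩
    refine ⟨Pi.single b n, fun c => ?_, ?_⟩
    · by_cases h : c = b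
      · subst h; simpa using hn
      · simp [h]
    · rw [Finset.sum_eq_single b (fun c _ hc => by simp [hc]) (by simp)]
      simp
  · exact ⟨0, fun _ => zero_mem _, by simp⟩
  · intro x y hx hy
    obtain ⟨n, hn, rfl⟩ := hx
    obtain ⟨n', hn', rfl⟩ := hy
    exact ⟨n + n', fun b => add_mem (hn b) (hn' b), by simp [mul_add, Finset.sum_add_distrib]⟩

theorem mul_mem_fiberSpan_of {M : Submodule ℚ R} {z x : R}
    (hz : ∀ b, ∀ n ∈ M, z * (L.fiberBasis v N b * n) ∈ L.fiberSpan v N M)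
    (hx : x ∈ L.fiberSpan v N M) : z * x ∈ L.fiberSpan v N M := by
  refine Submodule.iSup_induction _ (motive := fun x => z * x ∈ L.fiberSpan v N M) hx ?_ ?_ ?_
  · rintro b _ ⟨n, hn, rfl⟩
    exact hz b n hn
  · rw [mul_zero]; exact zero_mem _
  · intro x y hx hy
    rw [mul_add]; exact add_mem hx hy

theorem IsStable.ω_mul_mem {T : Finset V} {M : Submodule ℚ R} (hM : L.IsStable T M) (hg : 0 < g)
    {u : V} (hu : u ∈ T) {n : R} (hn : n ∈ M) : L.ω u * n ∈ M := by
  rw [L.ω_eq (false, ⟨0, hg⟩), smul_mul_assoc, mul_assoc]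
  exact M.smul_mem _ (hM.h_mul_mem _ u hu _ (hM.h_mul_mem _ u hu _ hn))

/-- An old letter passes each basis element of the fibre up to sign and is then absorbed by `M`. -/
theorem odd_mul_mem_fiberSpan (hg : 0 < g) {M : Submodule ℚ R} {z : R}
    (hh : ∀ a, z * L.h a v = -(L.h a v * z)) (hγ : ∀ w, z * L.γ v w = -(L.γ v w * z))
    (hz : ∀ n ∈ M, z * n ∈ M) {x : R} (hx : x ∈ L.fiberSpan v N M) :
    z * x ∈ L.fiberSpan v N M := by
  refine mul_mem_fiberSpan_of v (fun b n hn => ?_) hx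
  have h := mul_mem_fiberSpan (L := L) v b (hz n hn)
  rw [← mul_assoc] at h ⊢
  cases b with
  | one => simpa [fiberBasis] using h
  | form a => rw [fiberBasis, hh, neg_mul]; exact neg_mem h
  | point => rw [fiberBasis, L.mul_ω_comm hg hh]; exact h
  | edge w => rw [fiberBasis, hγ, neg_mul]; exact neg_mem h

/-- A product of a new letter and a basis element is rewritten by the relations as basis elements
times letters of `T`; the clique condition supplies the triangle relation for two new edges. -/
theorem IsStable.fiberSpan [DecidableEq V] {T : Finset V} {M : Submodule ℚ R}
    (hM : L.IsStable T M) (hg : 0 < g) (hNT : N ⊆ T) (hTN : ∀ w ∈ T, Γ.Adj v w → w ∈ N)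
    (hN : ∀ u ∈ N, ∀ w ∈ N, u ≠ w → Γ.Adj u w) (hadj : ∀ u ∈ N, Γ.Adj v u) :
    L.IsStable (insert v T) (L.fiberSpan v N M) := by
  have hform : ∀ a, ∀ x ∈ L.fiberSpan v N M, L.h a v * x ∈ L.fiberSpan v N M := by
    intro a x hx
    refine mul_mem_fiberSpan_of v (fun b n hn => ?_) hx
    cases b with
    | one => simpa [fiberBasis] using mul_mem_fiberSpan (L := L) v (N := N) (.form a) hn
    | form b =>
      rw [fiberBasis, ← mul_assoc, L.h_mul_h, smul_mul_assoc]
      exact Submodule.smul_mem _ _ (mul_mem_fiberSpan (L := L) v (N := N) .point hn)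
    | point => rw [fiberBasis, ← mul_assoc, L.h_mul_ω, zero_mul]; exact zero_mem _
    | edge w =>
      rw [fiberBasis, ← mul_assoc, L.h_mul_γ, L.h_mul_γ_anticomm, neg_mul, mul_assoc]
      exact neg_mem (mul_mem_fiberSpan (L := L) v (.edge w) (hM.h_mul_mem a w (hNT w.2) n hn))
  have hedge : ∀ u ∈ T, ∀ x ∈ L.fiberSpan v N M, L.γ v u * x ∈ L.fiberSpan v N M := by
    intro u hu x hx
    by_cases huv : Γ.Adj v u
    swap
    · rw [L.γ_of_not_adj v u huv, zero_mul]; exact zero_mem _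
    have huN := hTN u hu huv
    have hmem : ∀ n ∈ M, L.γ v u * n ∈ L.fiberSpan v N M := fun n hn =>
      mul_mem_fiberSpan (L := L) v (.edge ⟨u, huN⟩) hn
    refine mul_mem_fiberSpan_of v (fun b n hn => ?_) hx
    cases b with
    | one => simpa [fiberBasis] using hmem n hn
    | form b =>
      rw [fiberBasis, ← mul_assoc, L.γ_mul_h, L.h_mul_γ, ← L.γ_mul_h, mul_assoc]
      exact hmem _ (hM.h_mul_mem b u hu n hn)
    | point =>
      rw [fiberBasis, ← mul_assoc, L.mul_ω_comm hg fun a => L.γ_mul_h _ _ _ _, L.ω_mul_γ hg,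
        ← L.mul_ω_comm hg fun a => L.γ_mul_h _ _ _ _, mul_assoc]
      exact hmem _ (hM.ω_mul_mem hg hu hn)
    | edge w =>
      have h1 := L.γ_mul_γ (u := v) (v := u) (w := w) (fun _ => huv) (hN u huN w w.2)
        (fun _ => (hadj w w.2).symm)
      rw [fiberBasis, ← mul_assoc, h1, L.γ_anticomm u w v w, L.γ_anticomm u w v u, sub_mul,
        neg_mul, neg_mul, mul_assoc, mul_assoc]
      have h2 := hM.γ_mul_mem u hu w (hNT w.2) n hn
      exact sub_mem (neg_mem (mul_mem_fiberSpan (L := L) v (.edge w) h2)) (neg_mem (hmem _ h2))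
  constructor
  · intro a u hu x hx
    rcases Finset.mem_insert.1 hu with rfl | hu
    · exact hform a x hx
    · exact odd_mul_mem_fiberSpan v hg (fun b => L.h_anticomm a u b v)
        (fun w => L.h_mul_γ_anticomm a u v w) (fun n hn => hM.h_mul_mem a u hu n hn) hx
  · intro u hu w hw x hx
    rcases Finset.mem_insert.1 hu with rfl | hu' <;>
      rcases Finset.mem_insert.1 hw with rfl | hw'
    · rw [L.γ_self, zero_mul]; exact zero_mem _
    · exact hedge w hw' x hx
    · rw [L.γ_symm]; exact hedge u hu' x hx
    · exact odd_mul_mem_fiberSpan v hg (fun b => L.γ_mul_h u w b v)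
        (fun x => L.γ_anticomm u w v x) (fun n hn => hM.γ_mul_mem u hu' w hw' n hn) hx

end FiberBasis

/-! ### Independence: detecting elements of the model on extended representations. -/

section Detection

variable {V : Type u} {Γ : SimpleGraph V} {g : ℕ}

/-- The basis elements carry the coordinate of `1` to the distinct coordinates, so they are
independent over the old letters. -/
theorem fiberBasis_extend_apply [DecidableEq V] {P : Type u} [AddCommGroup P] [Module ℚ P]
    {N : Finset V} (L : LetterSystem Γ g (Module.End ℚ P)) {v : V} (hg : 0 < g)
    (hN : ∀ u ∈ N, ∀ v ∈ N, u ≠ v → Γ.Adj u v) (hadj : ∀ u ∈ N, Γ.Adj v u)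
    (hγ : ∀ w, Γ.Adj v w → w ∉ N → ∀ u, L.γ u w = 0) [DecidableEq (FiberIndex g N)]
    (b : FiberIndex g N) (p : P) :
    (L.extend hg hN hadj hγ).fiberBasis v N b (Pi.single .one p) = Pi.single b p := by
  cases b with
  | one => rfl
  | form a =>
    change extendForm N L v a v _ = _
    rw [extendForm, if_pos rfl]
    ext c
    cases c <;> simp [Pi.single_apply]
  | point =>
    change (if v = v then newPoint N L else _) _ = _
    rw [if_pos rfl]
    ext c
    cases c <;> simp
  | edge w =>
    change extendγ N L v v w _ = _
    rw [extendγ, if_pos rfl, if_pos w.2]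
    ext c
    have h1 : restrictDiagonal N L w (Pi.single FiberIndex.one p) = p := by
      simp [restrictDiagonal_apply]
    cases c with
    | edge x =>
      by_cases h : x = w
      · simp [h, h1]
      · simp [h, mt Subtype.ext h]
    | _ => simp

/-- A property which transfers along the letters of a letter system transfers to the fiber
basis. -/
theorem lift_fiberBasis [LinearOrder V] {R : Type*} [Ring R] [Algebra ℚ R]
    (L : LetterSystem Γ g R) (hΓ : IsChordalGraph Γ) (hg : 0 < g) (v : V) (N : Finset V)
    (b : FiberIndex g N) :
    L.lift hΓ ((modelLetters Γ hg).fiberBasis v N b) = L.fiberBasis v N b := by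
  cases b with
  | one => exact map_one _
  | form a => exact L.lift_h hΓ hg a v
  | point =>
    rw [fiberBasis, fiberBasis, ω_eq _ (false, ⟨0, hg⟩), ω_eq _ (false, ⟨0, hg⟩), map_smul,
      map_mul, L.lift_h, L.lift_h]
  | edge w => exact L.lift_γ hΓ hg v w

/-- The map `φ` commutes with the letters of the vertices of `T`. -/
structure IsEquivariant {P P' : Type*} [AddCommGroup P] [Module ℚ P] [AddCommGroup P']
    [Module ℚ P'] (L : LetterSystem Γ g (Module.End ℚ P))
    (L' : LetterSystem Γ g (Module.End ℚ P')) (T : Finset V) (φ : P →ₗ[ℚ] P') : Prop where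
  map_h : ∀ a, ∀ u ∈ T, ∀ p, φ (L.h a u p) = L'.h a u (φ p)
  map_γ : ∀ u ∈ T, ∀ w ∈ T, ∀ p, φ (L.γ u w p) = L'.γ u w (φ p)

theorem IsEquivariant.map_fiberBasis {P P' : Type*} [AddCommGroup P] [Module ℚ P]
    [AddCommGroup P'] [Module ℚ P'] {L : LetterSystem Γ g (Module.End ℚ P)}
    {L' : LetterSystem Γ g (Module.End ℚ P')} {T : Finset V} {φ : P →ₗ[ℚ] P'}
    (h : L.IsEquivariant L' T φ) (hg : 0 < g) {v : V} (hv : v ∈ T) {N : Finset V} (hN : N ⊆ T)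
    (b : FiberIndex g N) (p : P) :
    φ (L.fiberBasis v N b p) = L'.fiberBasis v N b (φ p) := by
  cases b with
  | one => rfl
  | form a => exact h.map_h a v hv p
  | point =>
    simp only [fiberBasis]
    rw [ω_eq _ (false, ⟨0, hg⟩), ω_eq _ (false, ⟨0, hg⟩)]
    simp [h.map_h _ v hv]
  | edge w => exact h.map_γ v hv w (hN w.2) p

/-- A letter system on `T` extends along an elimination order, and the elements of the model which
are detected by the system of `T` give elements which are detected by the extension. -/
theorem exists_detecting_extension [LinearOrder V] (hΓ : IsChordalGraph Γ) (hg : 0 < g)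
    (l : List V) (T : Finset V) (hl : Γ.IsElimination T l) {P : Type u} [AddCommGroup P]
    [Module ℚ P] (L : LetterSystem Γ g (Module.End ℚ P)) (hL : ∀ w, w ∉ T → ∀ u, L.γ u w = 0) :
    ∃ (P' : Type u) (_ : AddCommGroup P') (_ : Module ℚ P')
      (L' : LetterSystem Γ g (Module.End ℚ P')) (φ : P →ₗ[ℚ] P'),
      Function.Injective φ ∧ L.IsEquivariant L' T φ ∧
      ∀ (f : Model Γ g →ₗ[ℚ] P'), (∀ a x, f (a * x) = L'.lift hΓ a (f x)) →
      ∀ (I : Ideal (Model Γ g)) (M : Submodule ℚ (Model Γ g)),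
        (modelLetters Γ hg).IsStable T M → (∀ n ∈ M, ∃ p, f n = φ p) →
        (∀ n ∈ M, f n = 0 → n ∈ I) →
        ∃ M' : Submodule ℚ (Model Γ g), M ≤ M' ∧
          (modelLetters Γ hg).IsStable (T ∪ l.toFinset) M' ∧ ∀ n ∈ M', f n = 0 → n ∈ I := by
  classical
  induction l generalizing T P with
  | nil =>
    refine ⟨P, inferInstance, inferInstance, L, LinearMap.id, Function.injective_id,
      ⟨fun _ _ _ _ => rfl, fun _ _ _ _ _ => rfl⟩, fun f hf I M hM _ hI => ⟨M, le_rfl, ?_, hI⟩⟩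
    simpa using hM
  | cons v l ih =>
    obtain ⟨hvT, hcl, hl⟩ := hl
    set N := T.filter fun w => Γ.Adj v w with hNdef
    have hNT : N ⊆ T := Finset.filter_subset _ _
    have hadj : ∀ u ∈ N, Γ.Adj v u := fun u hu => (Finset.mem_filter.1 hu).2
    have hN : ∀ u ∈ N, ∀ w ∈ N, u ≠ w → Γ.Adj u w := fun u hu w hw h =>
      hcl u (hNT hu) w (hNT hw) (hadj u hu) (hadj w hw) h
    have hTN : ∀ w ∈ T, Γ.Adj v w → w ∈ N := fun w hw h => Finset.mem_filter.2 ⟨hw, h⟩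
    have hγ : ∀ w, Γ.Adj v w → w ∉ N → ∀ u, L.γ u w = 0 := fun w h hw =>
      hL w fun hwT => hw (hTN w hwT h)
    let L₁ := L.extend hg hN hadj hγ
    have hL₁ : ∀ w, w ∉ insert v T → ∀ u, L₁.γ u w = 0 := by
      intro w hw u
      rw [Finset.mem_insert, not_or] at hw
      change extendγ N L v u w = 0
      unfold extendγ
      rw [if_neg fun h => hw.2 (hNT h), if_neg hw.1, hL w hw.2, extendOdd_zero, ite_self]
    obtain ⟨P', i1, i2, L', φ, hφ, heq, hdet⟩ := ih (insert v T) hl L₁ hL₁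
    -- The old representation sits in the extension as the coordinate of the basis element `1`.
    refine ⟨P', i1, i2, L', φ ∘ₗ LinearMap.single ℚ (fun _ : FiberIndex g N => P) .one,
      hφ.comp (Pi.single_injective (M := fun _ => P) FiberIndex.one), ⟨fun a u hu p => ?_, fun u hu w hw p => ?_⟩, ?_⟩
    · have hne : u ≠ v := fun h => hvT (h ▸ hu)
      simp only [LinearMap.comp_apply, LinearMap.single_apply]
      rw [← heq.map_h a u (Finset.mem_insert_of_mem hu)]
      congr 1
      change _ = extendForm N L v a u _
      rw [extendForm, if_neg hne]
      ext c
      cases c <;> simp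
    · have hne : u ≠ v := fun h => hvT (h ▸ hu)
      have hne' : w ≠ v := fun h => hvT (h ▸ hw)
      simp only [LinearMap.comp_apply, LinearMap.single_apply]
      rw [← heq.map_γ u (Finset.mem_insert_of_mem hu) w (Finset.mem_insert_of_mem hw)]
      congr 1
      change _ = extendγ N L v u w _
      rw [extendγ, if_neg hne, if_neg hne']
      ext c
      cases c <;> simp
    · intro f hf I M hM hfM hI
      let := Fintype.ofFinite (FiberIndex g N)
      -- A chosen preimage of `f n` in the old representation; the value outside `M` plays no role.
      let p : Model Γ g → P := fun n => if h : n ∈ M then (hfM n h).choose else 0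
      have hp : ∀ n ∈ M, f n = φ (Pi.single .one (p n)) := by
        intro n hn
        simp only [p, dif_pos hn]
        exact (hfM n hn).choose_spec
      have hsum : ∀ n : FiberIndex g N → Model Γ g, (∀ b, n b ∈ M) →
          f (∑ b, (modelLetters Γ hg).fiberBasis v N b * n b) = φ fun b => p (n b) := by
        intro n hn
        rw [map_sum, ← Finset.univ_sum_single fun b => p (n b), map_sum]
        refine Finset.sum_congr rfl fun b _ => ?_
        rw [hf, lift_fiberBasis, hp _ (hn b),
          ← heq.map_fiberBasis hg (Finset.mem_insert_self v T)
            (hNT.trans (Finset.subset_insert v T)), fiberBasis_extend_apply]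
      have h1 : ∀ x ∈ (modelLetters Γ hg).fiberSpan v N M, ∃ p, f x = φ p := by
        intro x hx
        obtain ⟨n, hn, rfl⟩ := exists_sum_of_mem_fiberSpan v hx
        exact ⟨_, hsum n hn⟩
      have h2 : ∀ x ∈ (modelLetters Γ hg).fiberSpan v N M, f x = 0 → x ∈ I := by
        intro x hx hx0
        obtain ⟨n, hn, rfl⟩ := exists_sum_of_mem_fiberSpan v hx
        rw [hsum n hn, ← map_zero φ] at hx0
        have h0 := hφ hx0
        -- Vanishing of the sum forces each coordinate to vanish, hence each coefficient lies in
        -- `I`; the coefficients stand on the right and `I` is a left ideal.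
        refine sum_mem fun b _ => I.mul_mem_left _ (hI _ (hn b) ?_)
        rw [hp _ (hn b), show p (n b) = 0 from congrFun h0 b, Pi.single_zero, map_zero]
      obtain ⟨M', hMM', hM', hI'⟩ := hdet f hf I ((modelLetters Γ hg).fiberSpan v N M)
        (hM.fiberSpan v hg hNT hTN hN hadj) h1 h2
      exact ⟨M', (le_fiberSpan v M).trans hMM', by simpa using hM', hI'⟩

end Detection

end LetterSystem

end CurveArrangement

/-! ### Linear quotients -/

/-- The left ideal is generated by a finite sequence of elements of degree one whose successive
colon ideals belong to `F`. -/
inductive HasLinearQuotients {k : Type v} {A : Type u} [Field k] [Ring A] [Algebra k A]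
    (𝒜 : ℕ → Submodule k A) (F : Set (Ideal A)) : Ideal A → Prop
  | bot : HasLinearQuotients 𝒜 F ⊥
  | sup_span {J I : Ideal A} {z : A} (hJ : HasLinearQuotients 𝒜 F J) (hz : z ∈ 𝒜 1) (hI : I ∈ F)
      (h : ∀ a, a * z ∈ J ↔ a ∈ I) : HasLinearQuotients 𝒜 F (J ⊔ Ideal.span {z})

theorem HasLinearQuotients.exists_sequence {k : Type v} {A : Type u} [Field k] [Ring A]
    [Algebra k A] {𝒜 : ℕ → Submodule k A} {F : Set (Ideal A)} {I : Ideal A}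
    (h : HasLinearQuotients 𝒜 F I) :
    ∃ (t : ℕ) (z : Fin t → A),
      Submodule.span A (Set.range z) = I ∧ (∀ i, z i ∈ 𝒜 1) ∧ HasColonsIn F z := by
  induction h with
  | bot => exact ⟨0, Fin.elim0, by simp, fun i => i.elim0, fun i => i.elim0⟩
  | @sup_span J I x _ hx hI h ih =>
    obtain ⟨t, z, hz, hz1, hzF⟩ := ih
    have hrange : Set.range (Fin.snoc z x : Fin (t + 1) → A) = Set.range z ∪ {x} := by
      rw [Fin.range_snoc, Set.union_singleton]
    have hcast : ∀ i : Fin t, (Fin.snoc z x : Fin (t + 1) → A) '' {j | j < i.castSucc} =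
        z '' {j | j < i} := by
      intro i
      ext y
      constructor
      · rintro ⟨j, hj, rfl⟩
        obtain ⟨j, rfl⟩ := Fin.exists_castSucc_eq.2 (ne_of_lt (lt_trans hj (Fin.castSucc_lt_last i)))
        exact ⟨j, hj, by rw [Fin.snoc_castSucc]⟩
      · rintro ⟨j, hj, rfl⟩
        exact ⟨j.castSucc, hj, by rw [Fin.snoc_castSucc]⟩
    have hlast : (Fin.snoc z x : Fin (t + 1) → A) '' {j | j < Fin.last t} = Set.range z := by
      ext y
      constructor
      · rintro ⟨j, hj, rfl⟩
        obtain ⟨j, rfl⟩ := Fin.exists_castSucc_eq.2 (ne_of_lt hj)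
        exact ⟨j, by rw [Fin.snoc_castSucc]⟩
      · rintro ⟨j, rfl⟩
        exact ⟨j.castSucc, Fin.castSucc_lt_last j, by rw [Fin.snoc_castSucc]⟩
    refine ⟨t + 1, Fin.snoc z x, ?_, fun i => ?_, fun i => ?_⟩
    · rw [hrange, Submodule.span_union, hz]
    · induction i using Fin.lastCases with
      | last => rwa [Fin.snoc_last]
      | cast i => rw [Fin.snoc_castSucc]; exact hz1 i
    · induction i using Fin.lastCases with
      | last =>
        refine ⟨I, hI, fun a => ?_⟩
        rw [hlast, Fin.snoc_last, hz]
        exact h a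
      | cast i =>
        rw [hcast, Fin.snoc_castSucc]
        exact hzF i

namespace CurveArrangement

/-- The names of the elements `h a u` and `γ u w` of a letter system. -/
inductive Letter (V : Type u) (g : ℕ) : Type u
  | form (a : FormIndex g) (u : V)
  | edge (u w : V)

variable {V : Type u} {Γ : SimpleGraph V} {g : ℕ}

/-- The vertices of the letter belong to `T`. -/
def Letter.IsIn (T : Finset V) : Letter V g → Prop
  | .form _ u => u ∈ T
  | .edge u w => u ∈ T ∧ w ∈ T

theorem Letter.IsIn.mono {T T' : Finset V} (h : T ⊆ T') {s : Letter V g} (hs : s.IsIn T) :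
    s.IsIn T' := by
  cases s with
  | form a u => exact h hs
  | edge u w => exact ⟨h hs.1, h hs.2⟩

namespace LetterSystem

/-- The value of a letter system at a letter. -/
def letter {R : Type*} [Ring R] [Algebra ℚ R] (L : LetterSystem Γ g R) : Letter V g → R
  | .form a u => L.h a u
  | .edge u w => L.γ u w

theorem lift_letter [LinearOrder V] {R : Type*} [Ring R] [Algebra ℚ R]
    (L : LetterSystem Γ g R) (hΓ : IsChordalGraph Γ) (hg : 0 < g) (s : Letter V g) :
    L.lift hΓ ((modelLetters Γ hg).letter s) = L.letter s := by
  cases s with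
  | form a u => exact L.lift_h hΓ hg a u
  | edge u w => exact L.lift_γ hΓ hg u w

theorem IsEquivariant.map_letter {P P' : Type*} [AddCommGroup P] [Module ℚ P]
    [AddCommGroup P'] [Module ℚ P'] {L : LetterSystem Γ g (Module.End ℚ P)}
    {L' : LetterSystem Γ g (Module.End ℚ P')} {T : Finset V} {φ : P →ₗ[ℚ] P'}
    (h : L.IsEquivariant L' T φ) {s : Letter V g} (hs : s.IsIn T) (p : P) :
    φ (L.letter s p) = L'.letter s (φ p) := by
  cases s with
  | form a u => exact h.map_h a u hs p
  | edge u w => exact h.map_γ u hs.1 w hs.2 p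

theorem letter_anticomm {R : Type*} [Ring R] [Algebra ℚ R] (L : LetterSystem Γ g R)
    (s t : Letter V g) : L.letter s * L.letter t = -(L.letter t * L.letter s) := by
  cases s <;> cases t
  · exact L.h_anticomm _ _ _ _
  · exact L.h_mul_γ_anticomm _ _ _ _
  · exact L.γ_mul_h _ _ _ _
  · exact L.γ_anticomm _ _ _ _

/-- The letter system in which the product of any two letters vanishes. -/
def ofSqZero {R : Type*} [Ring R] [Algebra ℚ R] (e : R) (he : e * e = 0)
    (A : FormIndex g → V → ℚ) (B : Sym2 V → ℚ) (hB : ∀ u w, ¬Γ.Adj u w → B s(u, w) = 0) :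
    LetterSystem Γ g R where
  h a u := A a u • e
  ω _ := 0
  γ u w := B s(u, w) • e
  γ_symm u w := by rw [Sym2.eq_swap]
  γ_of_not_adj u w h := by rw [hB u w h, zero_smul]
  h_anticomm := by simp [he]
  γ_mul_h := by simp [he]
  γ_anticomm := by simp [he]
  h_mul_h := by simp [he]
  h_mul_γ := by simp [he]
  triangle := by simp [he]

end LetterSystem

/-! ### Colon ideals of ideals generated by letters. -/

section Colon

variable [LinearOrder V]

/-- The left ideal of the model generated by a set of letters. -/
noncomputable def letterIdeal (Γ : SimpleGraph V) (hg : 0 < g) (S : Set (Letter V g)) :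
    Ideal (Model Γ g) :=
  Ideal.span ((modelLetters Γ hg).letter '' S)

theorem letter_mem_letterIdeal (hg : 0 < g) {S : Set (Letter V g)} {s : Letter V g}
    (hs : s ∈ S) : (modelLetters Γ hg).letter s ∈ letterIdeal Γ hg S :=
  Ideal.subset_span ⟨s, hs, rfl⟩

theorem letterIdeal_le (hg : 0 < g) {S : Set (Letter V g)} {I : Ideal (Model Γ g)}
    (h : ∀ s ∈ S, (modelLetters Γ hg).letter s ∈ I) : letterIdeal Γ hg S ≤ I := by
  refine Ideal.span_le.2 ?_
  rintro _ ⟨s, hs, rfl⟩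
  exact h s hs

theorem mul_mem_letterIdeal (hg : 0 < g) {S S' : Set (Letter V g)} {z : Model Γ g}
    (h : ∀ s ∈ S', (modelLetters Γ hg).letter s * z ∈ letterIdeal Γ hg S) {a : Model Γ g}
    (ha : a ∈ letterIdeal Γ hg S') : a * z ∈ letterIdeal Γ hg S := by
  refine Submodule.span_induction (p := fun a _ => a * z ∈ letterIdeal Γ hg S) ?_ ?_ ?_ ?_ ha
  · rintro _ ⟨s, hs, rfl⟩
    exact h s hs
  · rw [zero_mul]; exact zero_mem _
  · intro x y _ _ hx hy
    rw [add_mul]; exact add_mem hx hy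
  · intro c x _ hx
    rw [smul_eq_mul, mul_assoc]; exact Ideal.mul_mem_left _ c hx

/-- An upper bound for a colon ideal, by means of a letter system in which `p₀` is annihilated by
the letters in `S`, and the elements `1` and `z` have independent values at `s₀ p₀`. -/
theorem mem_letterIdeal_of_mul_mem (hΓ : IsChordalGraph Γ) (hg : 0 < g) {T : Finset V}
    {l : List V} (hl : Γ.IsElimination T l) (hcover : ∀ u, u ∈ T ∨ u ∈ l) {P : Type u}
    [AddCommGroup P] [Module ℚ P] (L : LetterSystem Γ g (Module.End ℚ P))
    (hL : ∀ w, w ∉ T → ∀ u, L.γ u w = 0) {S S' : Set (Letter V g)} (hST : ∀ s ∈ S, s.IsIn T)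
    (hST' : ∀ s ∈ S', s.IsIn T) {s₀ z : Letter V g} (hs₀ : s₀.IsIn T) (hz : z.IsIn T) {p₀ : P}
    (hS : ∀ s ∈ S, L.letter s p₀ = 0) (hS' : ∀ s ∈ S', L.letter s (L.letter s₀ p₀) = 0)
    (hone : ∀ s : Letter V g, s.IsIn T →
      (modelLetters Γ hg).letter s ∈ letterIdeal Γ hg S' ∨ s = z)
    (hzmul : ∀ s : Letter V g, s.IsIn T →
      (modelLetters Γ hg).letter s * (modelLetters Γ hg).letter z ∈ letterIdeal Γ hg S')
    (hind : ∀ r t : ℚ, r • L.letter s₀ p₀ + t • L.letter z (L.letter s₀ p₀) = 0 →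
      r = 0 ∧ (t = 0 ∨ (modelLetters Γ hg).letter z ∈ letterIdeal Γ hg S'))
    {a : Model Γ g} (ha : a * (modelLetters Γ hg).letter s₀ ∈ letterIdeal Γ hg S) :
    a ∈ letterIdeal Γ hg S' := by
  set I := letterIdeal Γ hg S' with hI
  obtain ⟨P', _, _, L', φ, hφ, heq, hdet⟩ :=
    LetterSystem.exists_detecting_extension hΓ hg l T hl L hL
  have hkill : ∀ (S : Set (Letter V g)) (p : P), (∀ s ∈ S, s.IsIn T) →
      (∀ s ∈ S, L.letter s p = 0) → ∀ x ∈ letterIdeal Γ hg S, L'.lift hΓ x (φ p) = 0 := by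
    intro S p hST hS x hx
    refine Submodule.span_induction (p := fun x _ => L'.lift hΓ x (φ p) = 0) ?_ ?_ ?_ ?_ hx
    · rintro _ ⟨s, hs, rfl⟩
      rw [L'.lift_letter, ← heq.map_letter (hST s hs), hS s hs, map_zero]
    · rw [map_zero, LinearMap.zero_apply]
    · intro x y _ _ hx hy
      rw [map_add, LinearMap.add_apply, hx, hy, add_zero]
    · intro c x _ hx
      rw [smul_eq_mul, map_mul, Module.End.mul_apply, hx, map_zero]
  let p := L.letter s₀ p₀
  -- The orbit map of `s₀ p₀`. It kills `I`, and the aim is that it kills nothing else.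
  let f : Model Γ g →ₗ[ℚ] P' := LinearMap.applyₗ (φ p) ∘ₗ (L'.lift hΓ).toLinearMap
  have hf : ∀ x, f x = L'.lift hΓ x (φ p) := fun x => rfl
  let zm := (modelLetters Γ hg).letter z
  have hfz : ∀ i ∈ I, ∀ r t : ℚ, f (i + (r • 1 + t • zm)) = φ (r • p + t • L.letter z p) := by
    intro i hi r t
    rw [map_add, hf i, hkill S' p hST' hS' i hi, zero_add, map_add, map_smul, map_smul, hf, hf,
      map_one, L'.lift_letter, ← heq.map_letter hz, map_add, map_smul, map_smul,
      Module.End.one_apply]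
  -- Modulo `I`, the letters of `T` generate from `1` at most `1` and `z`. This subspace is stable
  -- under these letters, and `hind` controls the kernel of `f` on it.
  let M : Submodule ℚ (Model Γ g) := I.restrictScalars ℚ ⊔ Submodule.span ℚ {1, zm}
  have hM : ∀ n ∈ M, ∃ i ∈ I, ∃ r t : ℚ, n = i + (r • 1 + t • zm) := by
    intro n hn
    obtain ⟨i, hi, y, hy, rfl⟩ := Submodule.mem_sup.1 hn
    obtain ⟨r, t, rfl⟩ := Submodule.mem_span_pair.1 hy
    exact ⟨i, hi, r, t, rfl⟩
  have hIM : ∀ i ∈ I, i ∈ M := fun i hi => Submodule.mem_sup_left hi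
  have hzM : zm ∈ M := Submodule.mem_sup_right (Submodule.subset_span (by simp))
  have hletter : ∀ s : Letter V g, s.IsIn T → ∀ n ∈ M,
      (modelLetters Γ hg).letter s * n ∈ M := by
    intro s hs n hn
    obtain ⟨i, hi, r, t, rfl⟩ := hM n hn
    rw [mul_add, mul_add, mul_smul_comm, mul_smul_comm, mul_one]
    refine add_mem (hIM _ (I.mul_mem_left _ hi)) (add_mem (M.smul_mem _ ?_)
      (M.smul_mem _ (hIM _ (hzmul s hs))))
    rcases hone s hs with h | rfl
    · exact hIM _ h
    · exact hzM
  obtain ⟨M', hMM', hM', hker⟩ := hdet f (fun a x => by rw [hf, map_mul]; rfl) I M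
    ⟨fun a u hu n hn => hletter (.form a u) hu n hn,
      fun u hu w hw n hn => hletter (.edge u w) ⟨hu, hw⟩ n hn⟩
    (fun n hn => by
      obtain ⟨i, hi, r, t, rfl⟩ := hM n hn
      exact ⟨_, hfz i hi r t⟩)
    (fun n hn h0 => by
      obtain ⟨i, hi, r, t, rfl⟩ := hM n hn
      rw [hfz i hi r t, ← map_zero φ] at h0
      obtain ⟨hr, ht⟩ := hind r t (hφ h0)
      rw [hr, zero_smul, zero_add]
      refine add_mem hi ?_
      rcases ht with ht | ht
      · rw [ht, zero_smul]; exact zero_mem _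
      · exact (I.restrictScalars ℚ).smul_mem t ht)
  have hmem : ∀ u, u ∈ T ∪ l.toFinset := fun u => by simpa using hcover u
  -- Every vertex lies in `T` or `l`, so the enlarged subspace is stable under all letters and
  -- contains `1`.
  have htop : M' = ⊤ := eq_top_of_letters_mul_mem hg
    (hMM' (Submodule.mem_sup_right (Submodule.subset_span (by simp))))
    (fun a u n hn => hM'.h_mul_mem a u (hmem u) n hn)
    (fun u w n hn => hM'.γ_mul_mem u (hmem u) w (hmem w) n hn)
  refine hker a (htop ▸ Submodule.mem_top) ?_
  have h1 := hkill S p₀ hST hS _ ha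
  rwa [map_mul, Module.End.mul_apply, L'.lift_letter, ← heq.map_letter hs₀] at h1

/-- The letters of the vertices of `T`, the edges from `v` to the vertices of `W` and the classes
of degree one of `v` with index in `D`. -/
def chainSet (T : Finset V) (v : V) (W : Finset V) (D : Finset (FormIndex g)) :
    Set (Letter V g) :=
  {s | s.IsIn T ∨ (∃ w ∈ W, s = .edge v w) ∨ ∃ c ∈ D, s = .form c v}

theorem isIn_of_mem_chainSet {T : Finset V} {v : V} {W : Finset V} {D : Finset (FormIndex g)}
    (hW : W ⊆ T) {s : Letter V g} (hs : s ∈ chainSet T v W D) : s.IsIn (insert v T) := by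
  rcases hs with hs | ⟨w, hw, rfl⟩ | ⟨c, -, rfl⟩
  · exact hs.mono (Finset.subset_insert v T)
  · exact ⟨Finset.mem_insert_self v T, Finset.mem_insert_of_mem (hW hw)⟩
  · exact Finset.mem_insert_self v T

theorem isIn_insert_cases {T : Finset V} {v : V} {s : Letter V g} (hs : s.IsIn (insert v T)) :
    s.IsIn T ∨ (∃ a, s = .form a v) ∨ (∃ u ∈ T, s = .edge v u) ∨ (∃ u ∈ T, s = .edge u v) ∨
      s = .edge v v := by
  cases s with
  | form a u =>
    rcases Finset.mem_insert.1 hs with rfl | hu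
    · exact Or.inr (Or.inl ⟨a, rfl⟩)
    · exact Or.inl hu
  | edge u w =>
    rcases Finset.mem_insert.1 hs.1 with rfl | hu <;> rcases Finset.mem_insert.1 hs.2 with rfl | hw
    · exact Or.inr (Or.inr (Or.inr (Or.inr rfl)))
    · exact Or.inr (Or.inr (Or.inl ⟨w, hw, rfl⟩))
    · exact Or.inr (Or.inr (Or.inr (Or.inl ⟨u, hu, rfl⟩)))
    · exact Or.inl ⟨hu, hw⟩

/-- To verify that the products with `z` of the letters of `insert v T` belong to a left ideal
which contains the letters of `T`, for a letter `z`, it is enough to consider the letters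
`h a v` and the edges at `v`. -/
theorem letter_mul_mem_of_insert (hg : 0 < g) {T : Finset V} {v : V} {I : Ideal (Model Γ g)}
    {z s : Letter V g} (hs : s.IsIn (insert v T))
    (hT : ∀ s : Letter V g, s.IsIn T → (modelLetters Γ hg).letter s ∈ I)
    (hform : ∀ a, s = .form a v →
      (modelLetters Γ hg).h a v * (modelLetters Γ hg).letter z ∈ I)
    (hedge : ∀ u ∈ T, Γ.Adj v u →
      (modelLetters Γ hg).γ v u * (modelLetters Γ hg).letter z ∈ I) :
    (modelLetters Γ hg).letter s * (modelLetters Γ hg).letter z ∈ I := by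
  have hedge' : ∀ u ∈ T, (modelLetters Γ hg).γ v u * (modelLetters Γ hg).letter z ∈ I := by
    intro u hu
    by_cases h : Γ.Adj v u
    · exact hedge u hu h
    · rw [(modelLetters Γ hg).γ_of_not_adj v u h, zero_mul]; exact zero_mem _
  rcases isIn_insert_cases hs with hs | ⟨a, rfl⟩ | ⟨u, hu, rfl⟩ | ⟨u, hu, rfl⟩ | rfl
  · rw [LetterSystem.letter_anticomm]
    exact neg_mem (I.mul_mem_left _ (hT s hs))
  · exact hform a rfl
  · exact hedge' u hu
  · rw [LetterSystem.letter, LetterSystem.γ_symm]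
    exact hedge' u hu
  · rw [LetterSystem.letter, LetterSystem.γ_self, zero_mul]
    exact zero_mem _

/-- For the inclusion from right to left, old letters anticommute with `γ v w`, forms at `v` become
forms at `w`, and for another edge at `v` the triangle relation produces an edge inside `T`. -/
theorem chainSet_colon_edge (hΓ : IsChordalGraph Γ) (hg : 0 < g) {T : Finset V} {v : V}
    {l : List V} (hl : Γ.IsElimination T (v :: l)) (hcover : ∀ u, u ∈ insert v T ∨ u ∈ l)
    {W : Finset V} (hW : W ⊆ T) {w : V} (hwT : w ∈ T) (hvw : Γ.Adj v w) (hwW : w ∉ W)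
    (a : Model Γ g) :
    a * (modelLetters Γ hg).letter (.edge v w) ∈ letterIdeal Γ hg (chainSet T v W ∅) ↔
      a ∈ letterIdeal Γ hg {s | s.IsIn (insert v T)} := by
  obtain ⟨hvT, hcl, hl⟩ := hl
  have hin : (Letter.edge v w : Letter V g).IsIn (insert v T) :=
    ⟨Finset.mem_insert_self v T, Finset.mem_insert_of_mem hwT⟩
  have hTI : ∀ s : Letter V g, s.IsIn T →
      (modelLetters Γ hg).letter s ∈ letterIdeal Γ hg (chainSet T v W ∅) := fun s hs =>
    letter_mem_letterIdeal hg (Or.inl hs)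
  constructor
  -- A two-dimensional representation in which `γ v w` is the only edge acting and all forms act by
  -- zero. Its cyclic vector is killed by the generators of the chain, and its image under `γ v w`
  -- is nonzero and killed by all letters.
  · let e : Module.End ℚ (ULift.{u} ℚ × ULift.{u} ℚ) :=
      LinearMap.inr ℚ _ _ ∘ₗ LinearMap.fst ℚ _ _
    have he : e * e = 0 := by ext <;> simp [e]
    let L : LetterSystem Γ g (Module.End ℚ (ULift.{u} ℚ × ULift.{u} ℚ)) :=
      LetterSystem.ofSqZero e he 0 (fun x => if x = s(v, w) then 1 else 0) (by
        intro x y hxy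
        rw [if_neg]
        intro h
        exact hxy ((Γ.mem_edgeSet (v := x)).1 (h ▸ hvw)))
    have hprod : ∀ s t p, L.letter s (L.letter t p) = 0 := by
      intro s t p
      have : ∀ s, ∃ r : ℚ, L.letter s = r • e := fun s => by
        cases s
        exacts [⟨_, rfl⟩, ⟨_, rfl⟩]
      obtain ⟨r, hr⟩ := this s
      obtain ⟨r', hr'⟩ := this t
      rw [hr, hr', LinearMap.smul_apply, LinearMap.smul_apply, map_smul, ← Module.End.mul_apply,
        he]
      simp
    have hs₀ : L.letter (.edge v w) = e := by
      change (if s(v, w) = s(v, w) then (1 : ℚ) else 0) • e = e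
      rw [if_pos rfl, one_smul]
    refine mem_letterIdeal_of_mul_mem hΓ hg hl hcover L ?_ (fun s => isIn_of_mem_chainSet hW)
      -- The auxiliary letter `z` is taken to be `s₀`, which lies in the target ideal, so only the
      -- class of `1` remains to be detected.
      (fun s hs => hs) hin hin (p₀ := (⟨1⟩, 0)) ?_ (fun s _ => hprod _ _ _)
      (fun s hs => Or.inl (letter_mem_letterIdeal hg hs))
      (fun s _ => Ideal.mul_mem_left _ _ (letter_mem_letterIdeal hg hin)) ?_
    · intro x hx y
      change (if s(y, x) = s(v, w) then (1 : ℚ) else 0) • e = 0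
      rw [if_neg, zero_smul]
      intro h
      refine hx ?_
      rcases Sym2.eq_iff.1 h with ⟨-, rfl⟩ | ⟨-, rfl⟩
      · exact Finset.mem_insert_of_mem hwT
      · exact Finset.mem_insert_self _ _
    · have h0 : ∀ x y, s(x, y) ≠ s(v, w) → L.letter (.edge x y) = 0 := by
        intro x y h
        change (if s(x, y) = s(v, w) then (1 : ℚ) else 0) • e = 0
        rw [if_neg h, zero_smul]
      rintro s (hs | ⟨x, hx, rfl⟩ | ⟨c, hc, -⟩)
      · cases s with
        | form a u => exact LinearMap.congr_fun (zero_smul ℚ e) _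
        | edge x y =>
          rw [h0 x y, LinearMap.zero_apply]
          intro h
          rcases Sym2.eq_iff.1 h with ⟨rfl, -⟩ | ⟨-, rfl⟩
          · exact hvT hs.1
          · exact hvT hs.2
      · rw [h0 v x, LinearMap.zero_apply]
        intro h
        rcases Sym2.eq_iff.1 h with ⟨-, rfl⟩ | ⟨rfl, -⟩
        · exact hwW hx
        · exact hvT hwT
      · simp at hc
    · intro r t h
      rw [hprod, smul_zero, add_zero, hs₀] at h
      refine ⟨?_, Or.inr (letter_mem_letterIdeal hg hin)⟩
      simpa [e] using congrArg (fun x => x.2.down) h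
  · refine mul_mem_letterIdeal hg fun s hs => ?_
    refine letter_mul_mem_of_insert hg hs hTI (fun b _ => ?_) (fun x hx hvx => ?_)
    · rw [LetterSystem.letter, LetterSystem.h_mul_γ, LetterSystem.h_mul_γ_anticomm]
      exact neg_mem (Ideal.mul_mem_left _ _ (hTI (.form b w) hwT))
    · have h1 := (modelLetters Γ hg).γ_mul_γ (u := v) (v := x) (w := w) (fun _ => hvx)
        (fun h => hcl x hx w hwT hvx hvw h) (fun _ => hvw.symm)
      rw [LetterSystem.letter, h1, LetterSystem.γ_anticomm _ x w v w,
        LetterSystem.γ_anticomm _ x w v x]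
      have h2 := hTI (.edge x w) ⟨hx, hwT⟩
      exact sub_mem (neg_mem (Ideal.mul_mem_left _ _ h2)) (neg_mem (Ideal.mul_mem_left _ _ h2))

theorem γ_mul_h_mem (hg : 0 < g) {T : Finset V} {v : V} {I : Ideal (Model Γ g)}
    (hT : ∀ s : Letter V g, s.IsIn T → (modelLetters Γ hg).letter s ∈ I) (a : FormIndex g) {u : V}
    (hu : u ∈ T) : (modelLetters Γ hg).γ v u * (modelLetters Γ hg).h a v ∈ I := by
  rw [LetterSystem.γ_mul_h, LetterSystem.h_mul_γ, ← LetterSystem.γ_mul_h]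
  exact I.mul_mem_left _ (hT (.form a u) hu)

/-- Once some `h d v` is in the ideal, so is `ω v`, and with it every product of two forms at `v`.
The colon ideal is therefore the full one. -/
theorem chainSet_colon_form_of_nonempty (hΓ : IsChordalGraph Γ) (hg : 0 < g) {T : Finset V}
    {v : V} {l : List V} (hl : Γ.IsElimination T (v :: l))
    (hcover : ∀ u, u ∈ insert v T ∨ u ∈ l) {W : Finset V} (hW : W ⊆ T)
    {D : Finset (FormIndex g)} (hD : D.Nonempty) {b : FormIndex g} (hb : b ∉ D)
    (a : Model Γ g) :
    a * (modelLetters Γ hg).letter (.form b v) ∈ letterIdeal Γ hg (chainSet T v W D) ↔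
      a ∈ letterIdeal Γ hg {s | s.IsIn (insert v T)} := by
  obtain ⟨hvT, hcl, hl⟩ := hl
  have hin : (Letter.form b v : Letter V g).IsIn (insert v T) := Finset.mem_insert_self v T
  have hTI : ∀ s : Letter V g, s.IsIn T →
      (modelLetters Γ hg).letter s ∈ letterIdeal Γ hg (chainSet T v W D) := fun s hs =>
    letter_mem_letterIdeal hg (Or.inl hs)
  constructor
  · let e : Module.End ℚ (ULift.{u} ℚ × ULift.{u} ℚ) :=
      LinearMap.inr ℚ _ _ ∘ₗ LinearMap.fst ℚ _ _
    have he : e * e = 0 := by ext <;> simp [e]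
    let L : LetterSystem Γ g (Module.End ℚ (ULift.{u} ℚ × ULift.{u} ℚ)) :=
      LetterSystem.ofSqZero e he (fun c u => if c = b ∧ u = v then 1 else 0) 0 (by simp)
    have hprod : ∀ s t p, L.letter s (L.letter t p) = 0 := by
      intro s t p
      have : ∀ s, ∃ r : ℚ, L.letter s = r • e := fun s => by
        cases s
        exacts [⟨_, rfl⟩, ⟨_, rfl⟩]
      obtain ⟨r, hr⟩ := this s
      obtain ⟨r', hr'⟩ := this t
      rw [hr, hr', LinearMap.smul_apply, LinearMap.smul_apply, map_smul, ← Module.End.mul_apply,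
        he]
      simp
    have hs₀ : L.letter (.form b v) = e := by
      change (if b = b ∧ v = v then (1 : ℚ) else 0) • e = e
      rw [if_pos ⟨rfl, rfl⟩, one_smul]
    have hedge : ∀ x y, L.letter (.edge x y) = 0 := fun x y => zero_smul ℚ e
    refine mem_letterIdeal_of_mul_mem hΓ hg hl hcover L (fun x _ y => hedge y x)
      (fun s => isIn_of_mem_chainSet hW)
      (fun s hs => hs) hin hin (p₀ := (⟨1⟩, 0)) ?_ (fun s _ => hprod _ _ _)
      (fun s hs => Or.inl (letter_mem_letterIdeal hg hs))
      (fun s _ => Ideal.mul_mem_left _ _ (letter_mem_letterIdeal hg hin)) ?_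
    · have h0 : ∀ c x, ¬(c = b ∧ x = v) → L.letter (.form c x) = 0 := by
        intro c x h
        change (if c = b ∧ x = v then (1 : ℚ) else 0) • e = 0
        rw [if_neg h, zero_smul]
      rintro s (hs | ⟨x, hx, rfl⟩ | ⟨c, hc, rfl⟩)
      · cases s with
        | form c x =>
          rw [h0 c x, LinearMap.zero_apply]
          rintro ⟨-, rfl⟩
          exact hvT hs
        | edge x y => rw [hedge, LinearMap.zero_apply]
      · rw [hedge, LinearMap.zero_apply]
      · rw [h0 c v, LinearMap.zero_apply]
        rintro ⟨rfl, -⟩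
        exact hb hc
    · intro r t h
      rw [hprod, smul_zero, add_zero, hs₀] at h
      refine ⟨?_, Or.inr (letter_mem_letterIdeal hg hin)⟩
      simpa [e] using congrArg (fun x => x.2.down) h
  · refine mul_mem_letterIdeal hg fun s hs => ?_
    refine letter_mul_mem_of_insert hg hs hTI (fun c _ => ?_)
      (fun x hx _ => γ_mul_h_mem hg hTI b hx)
    obtain ⟨d, hd⟩ := hD
    rw [LetterSystem.letter, LetterSystem.h_mul_h, LetterSystem.ω_eq _ d.conj,
      FormIndex.conj_conj]
    refine ((letterIdeal Γ hg _).restrictScalars ℚ).smul_mem _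
      (((letterIdeal Γ hg _).restrictScalars ℚ).smul_mem _ ?_)
    exact Ideal.mul_mem_left _ _
      (letter_mem_letterIdeal hg (s := .form d v) (Or.inr (Or.inr ⟨d, hd, rfl⟩)))

/-- Among the letters of `insert v T`, only the dual form has a product with `h b v` outside the
ideal: other forms at `v` give zero, and edges at `v` move the form to an old vertex. -/
theorem chainSet_colon_form (hΓ : IsChordalGraph Γ) (hg : 0 < g) {T : Finset V}
    {v : V} {l : List V} (hl : Γ.IsElimination T (v :: l))
    (hcover : ∀ u, u ∈ insert v T ∨ u ∈ l) {W : Finset V} (hW : W ⊆ T) (b : FormIndex g)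
    (a : Model Γ g) :
    a * (modelLetters Γ hg).letter (.form b v) ∈ letterIdeal Γ hg (chainSet T v W ∅) ↔
      a ∈ letterIdeal Γ hg {s | s.IsIn (insert v T) ∧ s ≠ .form b.conj v} := by
  obtain ⟨hvT, hcl, hl⟩ := hl
  have hin : ∀ c, (Letter.form c v : Letter V g).IsIn (insert v T) := fun _ =>
    Finset.mem_insert_self v T
  have hTI : ∀ s : Letter V g, s.IsIn T →
      (modelLetters Γ hg).letter s ∈ letterIdeal Γ hg (chainSet T v W ∅) := fun s hs =>
    letter_mem_letterIdeal hg (Or.inl hs)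
  constructor
  -- The zero system on `ℚ` extended by `v` without neighbours is the cohomology of the curve, with
  -- only the forms at `v` acting. The vector `p₀` is the unit class, `h b v` sends it to the class
  -- of the form, and the dual form sends that to a nonzero multiple of the point class.
  · let L₀ : LetterSystem Γ g (Module.End ℚ (ULift.{u} ℚ)) :=
      LetterSystem.ofSqZero 0 (zero_mul 0) 0 0 (by simp)
    have hγ₀ : ∀ x y, L₀.γ x y = 0 := fun x y => smul_zero _
    have hh₀ : ∀ c x, L₀.h c x = 0 := fun c x => smul_zero _
    let L := L₀.extend (N := ∅) (v := v) hg (by simp) (by simp) (fun w _ _ u => hγ₀ u w)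
    have hedge : ∀ x y, L.letter (.edge x y) = 0 := by
      intro x y
      change LetterSystem.extendγ ∅ L₀ v x y = 0
      simp [LetterSystem.extendγ, hγ₀, LetterSystem.extendOdd_zero]
    have hform : ∀ c x, x ≠ v → L.letter (.form c x) = 0 := by
      intro c x hx
      change LetterSystem.extendForm ∅ L₀ v c x = 0
      simp [LetterSystem.extendForm, hh₀, LetterSystem.extendOdd_zero, hx]
    have hformv : ∀ c, L.letter (.form c v) = LetterSystem.newForm ∅ L₀ c := by
      intro c
      change LetterSystem.extendForm ∅ L₀ v c v = _
      rw [LetterSystem.extendForm, if_pos rfl]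
    have hprod : ∀ c p, L.letter (.form c v) (L.letter (.form b v) p) =
        pairing c b • LetterSystem.newPoint ∅ L₀ p := by
      intro c p
      rw [hformv, hformv]
      exact LinearMap.congr_fun (LetterSystem.newForm_mul_newForm ∅ L₀ c b) p
    let p₀ : FiberIndex g (∅ : Finset V) → ULift.{u} ℚ := fun
      | .one => ⟨1⟩
      | _ => 0
    refine mem_letterIdeal_of_mul_mem hΓ hg hl hcover L (fun x _ y => hedge y x)
      (fun s => isIn_of_mem_chainSet hW) (fun s hs => hs.1) (hin b) (hin b.conj) (p₀ := p₀)
      ?_ ?_ ?_ ?_ ?_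
    · rintro s (hs | ⟨x, hx, rfl⟩ | ⟨c, hc, -⟩)
      · cases s with
        | form c x =>
          rw [hform, LinearMap.zero_apply]
          rintro rfl
          exact hvT hs
        | edge x y => rw [hedge, LinearMap.zero_apply]
      · rw [hedge, LinearMap.zero_apply]
      · simp at hc
    · rintro s ⟨hs, hne⟩
      cases s with
      | form c x =>
        by_cases hx : x = v
        · subst hx
          rw [hprod, pairing_of_ne, zero_smul]
          rintro rfl
          simp at hne
        · rw [hform c x hx, LinearMap.zero_apply]
      | edge x y => rw [hedge, LinearMap.zero_apply]
    · intro s hs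
      by_cases h : s = .form b.conj v
      · exact Or.inr h
      · exact Or.inl (letter_mem_letterIdeal hg ⟨hs, h⟩)
    · have hTI' : ∀ s : Letter V g, s.IsIn (insert v T) → s ≠ .form b.conj v →
          (modelLetters Γ hg).letter s ∈
            letterIdeal Γ hg {s | s.IsIn (insert v T) ∧ s ≠ .form b.conj v} := fun s hs h =>
        letter_mem_letterIdeal hg ⟨hs, h⟩
      intro s hs
      refine letter_mul_mem_of_insert hg hs (fun s hs => ?_) (fun c _ => ?_) (fun x hx _ => ?_)
      · refine hTI' s (hs.mono (Finset.subset_insert v T)) ?_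
        rintro rfl
        exact hvT hs
      · rw [LetterSystem.letter, LetterSystem.h_mul_h, LetterSystem.ω_eq _ b.conj,
          FormIndex.conj_conj]
        refine ((letterIdeal Γ hg _).restrictScalars ℚ).smul_mem _
          (((letterIdeal Γ hg _).restrictScalars ℚ).smul_mem _ ?_)
        refine Ideal.mul_mem_left _ _ (hTI' (.form b v) (hin b) ?_)
        simpa using b.conj_ne.symm
      · rw [LetterSystem.letter, LetterSystem.γ_mul_h]
        refine neg_mem (Ideal.mul_mem_left _ _ (hTI' (.edge v x) ⟨hin b, ?_⟩ (by simp)))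
        exact Finset.mem_insert_of_mem hx
    -- The class of the form and the point class are independent, so both coefficients vanish.
    · intro r t h
      rw [hprod, hformv] at h
      have h1 := congrArg (fun f => (f (.form b)).down) h
      have h2 := congrArg (fun f => (f .point).down) h
      have h3 : pairing b.conj b ≠ 0 := by
        simpa using pairing_conj_ne_zero b.conj
      have hr : r = 0 := by simpa [p₀] using h1
      refine ⟨hr, Or.inl ?_⟩
      simpa [p₀, hr, h3] using h2
  · refine mul_mem_letterIdeal hg fun s hs => ?_
    refine letter_mul_mem_of_insert hg hs.1 hTI (fun c hc => ?_)
      (fun x hx _ => γ_mul_h_mem hg hTI b hx)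
    rw [LetterSystem.letter, LetterSystem.h_mul_h_of_ne]
    · exact zero_mem _
    · rintro rfl
      exact hs.2 (by simpa using hc)

end Colon

end CurveArrangement

namespace CurveArrangement

variable {V : Type u} [LinearOrder V] {Γ : SimpleGraph V} {g : ℕ}

/-! ### The Koszul filtration of the model -/

/-- An elimination ordering of all vertices, divided into the set of the vertices which have been
added and the list of those which remain. -/
inductive IsStage (Γ : SimpleGraph V) : Finset V → List V → Prop
  | start {l : List V} (hl : Γ.IsElimination ∅ l) (h : ∀ u, u ∈ l) : IsStage Γ ∅ l
  | insert {T : Finset V} {v : V} {l : List V} (h : IsStage Γ T (v :: l)) :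
      IsStage Γ (insert v T) l

theorem IsStage.isElimination {T : Finset V} {l : List V} (h : IsStage Γ T l) :
    Γ.IsElimination T l := by
  induction h with
  | start hl _ => exact hl
  | insert _ ih => exact ih.2.2

theorem IsStage.mem_or_mem {T : Finset V} {l : List V} (h : IsStage Γ T l) (u : V) :
    u ∈ T ∨ u ∈ l := by
  induction h with
  | start _ h => exact Or.inr (h u)
  | @insert T v l _ ih =>
    rcases ih with h | h
    · exact Or.inl (Finset.mem_insert_of_mem h)
    · rcases List.mem_cons.1 h with rfl | h
      · exact Or.inl (Finset.mem_insert_self _ _)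
      · exact Or.inr h

theorem IsStage.exists_nil {T : Finset V} {l : List V} (h : IsStage Γ T l) :
    ∃ T', IsStage Γ T' [] := by
  induction l generalizing T with
  | nil => exact ⟨T, h⟩
  | cons v l ih => exact ih h.insert

/-- The ideals generated by the letters of an initial segment of an elimination ordering, with
at most one class of degree one of the last vertex left out. -/
def koszulFiltration (Γ : SimpleGraph V) (hg : 0 < g) : Set (Ideal (Model Γ g)) :=
  {I | I = ⊥ ∨ ∃ T v l, IsStage Γ T (v :: l) ∧
    (I = letterIdeal Γ hg {s | s.IsIn (insert v T)} ∨
      ∃ c, I = letterIdeal Γ hg {s | s.IsIn (insert v T) ∧ s ≠ .form c v})}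

theorem letterIdeal_union_singleton (hg : 0 < g) {S S' : Set (Letter V g)} {s : Letter V g}
    (h : ∀ t, t ∈ S' ↔ t ∈ S ∨ t = s) : letterIdeal Γ hg S' =
      letterIdeal Γ hg S ⊔ Ideal.span {(modelLetters Γ hg).letter s} := by
  have : S' = S ∪ {s} := Set.ext h
  rw [this, letterIdeal, Set.image_union, Ideal.span_union, Set.image_singleton]
  rfl

theorem letter_mem_modelGrading (hg : 0 < g) (s : Letter V g) :
    (modelLetters Γ hg).letter s ∈ modelGrading Γ g 1 := by
  cases s with
  | form a u => exact modelLetters_h_mem hg a u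
  | edge u w => exact modelLetters_γ_mem hg u w

/-- The edges at `v` are adjoined before the forms. The first form omits its dual from the colon
ideal, while every other step has the full ideal of `insert v T`. -/
theorem hasLinearQuotients_chainSet (hΓ : IsChordalGraph Γ) (hg : 0 < g) {T : Finset V} {v : V}
    {l : List V} (h : IsStage Γ T (v :: l))
    (hT : HasLinearQuotients (modelGrading Γ g) (koszulFiltration Γ hg)
      (letterIdeal Γ hg {s | s.IsIn T}))
    {W : Finset V} (hW : ∀ w ∈ W, w ∈ T ∧ Γ.Adj v w) (D : Finset (FormIndex g)) :
    HasLinearQuotients (modelGrading Γ g) (koszulFiltration Γ hg)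
      (letterIdeal Γ hg (chainSet T v W D)) := by
  have hcover : ∀ u, u ∈ insert v T ∨ u ∈ l := h.insert.mem_or_mem
  have hfull : letterIdeal Γ hg {s | s.IsIn (insert v T)} ∈ koszulFiltration Γ hg :=
    Or.inr ⟨T, v, l, h, Or.inl rfl⟩
  induction D using Finset.induction_on with
  | empty =>
    induction W using Finset.induction_on with
    | empty =>
      convert hT using 3
      simp [chainSet]
    | insert w W hw ih =>
      have hW' : ∀ w ∈ W, w ∈ T ∧ Γ.Adj v w := fun x hx => hW x (Finset.mem_insert_of_mem hx)
      obtain ⟨hwT, hvw⟩ := hW w (Finset.mem_insert_self w W)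
      rw [letterIdeal_union_singleton hg (S := chainSet T v W ∅) (s := .edge v w)]
      · exact (ih hW').sup_span (letter_mem_modelGrading hg _) hfull
          (chainSet_colon_edge hΓ hg h.isElimination hcover (fun x hx => (hW' x hx).1) hwT hvw hw)
      · intro t
        simp only [chainSet, Set.mem_ofPred_eq, Finset.mem_insert, exists_eq_or_imp,
          Finset.notMem_empty, false_and, exists_false, or_comm, or_left_comm]
  | insert b D hb ih =>
    have hWT : W ⊆ T := fun x hx => (hW x hx).1
    rw [letterIdeal_union_singleton hg (S := chainSet T v W D) (s := .form b v)]
    · rcases D.eq_empty_or_nonempty with rfl | hD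
      · exact ih.sup_span (letter_mem_modelGrading hg _) (Or.inr ⟨T, v, l, h, Or.inr ⟨_, rfl⟩⟩)
          (chainSet_colon_form hΓ hg h.isElimination hcover hWT b)
      · exact ih.sup_span (letter_mem_modelGrading hg _) hfull
          (chainSet_colon_form_of_nonempty hΓ hg h.isElimination hcover hWT hD hb)
    · intro t
      simp only [chainSet, Set.mem_ofPred_eq, Finset.mem_insert, exists_eq_or_imp,
        or_comm, or_left_comm]

/-- The chain lists each edge at `v` in one orientation and only for neighbours; the other letters
of edges at `v` are equal to these or zero. -/
theorem letterIdeal_chainSet (hg : 0 < g) {T W : Finset V} {v : V}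
    (hW : ∀ w, w ∈ W ↔ w ∈ T ∧ Γ.Adj v w) {D : Finset (FormIndex g)} {S : Set (Letter V g)}
    (hS : ∀ s, s ∈ S ↔ s.IsIn (insert v T) ∧ ∀ a, s = .form a v → s.IsIn T ∨ a ∈ D) :
    letterIdeal Γ hg (chainSet T v W D) = letterIdeal Γ hg S := by
  apply le_antisymm
  · refine letterIdeal_le hg fun s hs => letter_mem_letterIdeal hg ((hS s).2 ⟨?_, ?_⟩)
    · exact isIn_of_mem_chainSet (fun w hw => ((hW w).1 hw).1) hs
    · rintro a rfl
      rcases hs with hs | ⟨w, -, hw⟩ | ⟨c, hc, h⟩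
      · exact Or.inl hs
      · simp at hw
      · obtain ⟨rfl, -⟩ := Letter.form.inj h
        exact Or.inr hc
  · refine letterIdeal_le hg fun s hs => ?_
    obtain ⟨hs, hD⟩ := (hS s).1 hs
    have hedge : ∀ u ∈ T, (modelLetters Γ hg).γ v u ∈ letterIdeal Γ hg (chainSet T v W D) := by
      intro u hu
      by_cases hvu : Γ.Adj v u
      · exact letter_mem_letterIdeal hg (s := .edge v u)
          (Or.inr (Or.inl ⟨u, (hW u).2 ⟨hu, hvu⟩, rfl⟩))
      · rw [(modelLetters Γ hg).γ_of_not_adj v u hvu]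
        exact zero_mem _
    rcases isIn_insert_cases hs with hs | ⟨a, rfl⟩ | ⟨u, hu, rfl⟩ | ⟨u, hu, rfl⟩ | rfl
    · exact letter_mem_letterIdeal hg (Or.inl hs)
    · refine letter_mem_letterIdeal hg ?_
      rcases hD a rfl with h | h
      · exact Or.inl h
      · exact Or.inr (Or.inr ⟨a, h, rfl⟩)
    · exact hedge u hu
    · rw [LetterSystem.letter, LetterSystem.γ_symm]
      exact hedge u hu
    · rw [LetterSystem.letter, LetterSystem.γ_self]
      exact zero_mem _

theorem IsStage.hasLinearQuotients (hΓ : IsChordalGraph Γ) (hg : 0 < g) {T : Finset V}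
    {l : List V} (h : IsStage Γ T l) :
    HasLinearQuotients (modelGrading Γ g) (koszulFiltration Γ hg)
      (letterIdeal Γ hg {s | s.IsIn T}) := by
  classical
  induction h with
  | start _ _ =>
    have : letterIdeal Γ hg {s | s.IsIn ∅} = ⊥ := by
      refine le_bot_iff.1 (letterIdeal_le hg fun s hs => ?_)
      cases s with
      | form a u => exact absurd hs (Finset.notMem_empty u)
      | edge u w => exact absurd hs.1 (Finset.notMem_empty u)
    rw [this]
    exact .bot
  | @insert T v l h ih =>
    rw [← letterIdeal_chainSet hg (W := T.filter (Γ.Adj v)) (T := T) (v := v)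
      (D := Finset.univ) (fun w => Finset.mem_filter) (fun s => by simp)]
    exact hasLinearQuotients_chainSet hΓ hg h ih (fun w hw => Finset.mem_filter.1 hw) _

theorem isKoszulFiltration_koszulFiltration (hΓ : IsChordalGraph Γ) (hg : 0 < g) :
    IsKoszulFiltration (modelGrading Γ g) (koszulFiltration Γ hg) := by
  classical
  intro I hI
  refine HasLinearQuotients.exists_sequence ?_
  rcases hI with rfl | ⟨T, v, l, h, rfl | ⟨c, rfl⟩⟩
  · exact .bot
  · exact h.insert.hasLinearQuotients hΓ hg
  -- Omitting `h c v` only stops the same chain one form earlier, so no further colon ideals arise.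
  · rw [← letterIdeal_chainSet hg (W := T.filter (Γ.Adj v)) (T := T) (v := v)
      (D := Finset.univ.erase c) (fun w => Finset.mem_filter) ?_]
    · exact hasLinearQuotients_chainSet hΓ hg h (h.hasLinearQuotients hΓ hg)
        (fun w hw => Finset.mem_filter.1 hw) _
    · intro s
      refine and_congr_right fun _ => ⟨?_, ?_⟩
      · rintro hs a rfl
        refine Or.inr (Finset.mem_erase.2 ⟨?_, Finset.mem_univ a⟩)
        rintro rfl
        exact hs rfl
      · rintro hs rfl
        rcases hs c rfl with h' | h'
        · exact h.isElimination.1 h'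
        · exact Finset.notMem_erase c _ h'

theorem augmentationIdeal_mem_koszulFiltration [Finite V] (hΓ : IsChordalGraph Γ) (hg : 0 < g) :
    augmentationIdeal (modelGrading Γ g) ∈ koszulFiltration Γ hg := by
  cases nonempty_fintype V
  obtain ⟨l, hl, hel⟩ := SimpleGraph.exists_isElimination hΓ Finset.univ
  obtain ⟨T, hT⟩ := (IsStage.start hel fun u => (hl u).2 (Finset.mem_univ u)).exists_nil
  have hmem : ∀ u, u ∈ T := fun u => (hT.mem_or_mem u).resolve_right List.not_mem_nil
  have heq : augmentationIdeal (modelGrading Γ g) = letterIdeal Γ hg {s | s.IsIn T} := by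
    rw [augmentationIdeal_model hg, letterIdeal]
    congr 1
    ext z
    constructor
    · rintro (⟨a, u, rfl⟩ | ⟨u, w, rfl⟩)
      · exact ⟨.form a u, hmem u, rfl⟩
      · exact ⟨.edge u w, ⟨hmem u, hmem w⟩, rfl⟩
    · rintro ⟨s, -, rfl⟩
      cases s with
      | form a u => exact Or.inl ⟨a, u, rfl⟩
      | edge u w => exact Or.inr ⟨u, w, rfl⟩
  rw [heq]
  -- Without vertices the augmentation ideal is zero; otherwise it is the full ideal at the last
  -- vertex of the ordering.
  cases hT with
  | start _ _ =>
    refine Or.inl (le_bot_iff.1 (letterIdeal_le hg fun s _ => ?_))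
    cases s with
    | form a u => exact absurd (hmem u) (Finset.notMem_empty u)
    | edge u w => exact absurd (hmem u) (Finset.notMem_empty u)
  | insert h => exact Or.inr ⟨_, _, _, h, Or.inl rfl⟩

end CurveArrangement

/-- For a finite chordal graph `Γ`, whose vertices are ordered in any way, and a curve of genus
`g > 1`, the model of the complement of the chordal arrangement is a Koszul algebra. -/
theorem mainTheorem5 {V : Type*} [Finite V] [LinearOrder V] (Γ : SimpleGraph V)
    (hΓ : IsChordalGraph Γ) (g : ℕ) (hg : 1 < g) :
    IsKoszulAlgebra ℚ (CurveArrangement.modelGrading Γ g) := by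
  have hg' : 0 < g := lt_trans Nat.zero_lt_one hg
  exact ⟨CurveArrangement.isConnectedGrading_model hΓ,
    CurveArrangement.modelGrading_finiteDimensional,
    (CurveArrangement.isKoszulFiltration_koszulFiltration hΓ hg').hasLinearFreeResolution
      (CurveArrangement.augmentationIdeal_mem_koszulFiltration hΓ hg')⟩
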